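/- Let $(M,\Lambda)$ be a regular Poisson manifold ($M$ a smooth, finite-dimensional, Hausdorff, paracompact manifold without boundary; $\Lambda$ a bivector field such that $\{f,g\}=\Lambda(df,dg)$ satisfies the Jacobi identity; regular means that the map $\#_x:T_x^*M\to T_xM$, $\beta(\alpha^\#)=\Lambda(\alpha,\beta)$, has a rank that does not depend on $x$). Let $\mathcal F$ be its symplectic foliation, $T_x\mathcal F=\operatorname{im}\#_x$, and let $I(M)$ be the algebra of Casimir functions, i.e. of the $f\in C^\infty(M)$ with $(df)^\#=0$. Choose a transversal distribution $\nu\mathcal F$, so that $TM=T\mathcal F\oplus\nu\mathcal F$ and dually $T^*M=T^*\mathcal F\oplus\nu^*\mathcal F$. Let $\Omega_{p,q}(M)$ and $\mathcal V_{p,q}(M)$ be the spaces of smooth sections of $\wedge^q(T^*\mathcal F)\otimes\wedge^p(\nu^*\mathcal F)$ and $\wedge^q(T\mathcal F)\otimes\wedge^p(\nu\mathcal F)$, viewed as forms and as skew-symmetric contravariant tensor fields of degree $p+q$. Let $d'':\Omega_{p,q}(M)\to\Omega_{p,q+1}(M)$ and $\sigma'':\mathcal V_{p,q}(M)\to\mathcal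 V_{p,q+1}(M)$ be the components of type $(0,1)$ of the de Rham differential $d$ and of the Poisson coboundary operator $\sigma=[\Lambda,\cdot\,]$, $$\sigma Q(\alpha_0,\ldots,\alpha_k)=\sum_{i}(-1)^i\alpha_i^{\#}\bigl(Q(\alpha_0,\ldots,\widehat{\alpha_i},\ldots,\alpha_k)\bigr)+\sum_{i<j}(-1)^{i+j}Q(\{\alpha_i,\alpha_j\},\alpha_0,\ldots,\widehat{\alpha_i},\ldots,\widehat{\alpha_j},\ldots,\alpha_k),$$ where $\{\alpha,\beta\}=L_{\alpha^\#}\beta-L_{\beta^\#}\alpha-d(\Lambda(\alpha,\beta))$. Suppose that $\Omega_{1,0}(M)$ and $\mathcal V_{1,0}(M)$ are free $C^\infty(M)$-modules with bases $(\beta_i)_{i\in J}$ and $(X_i)_{i\in J}$ indexed by the same set $J$, and that $d''\beta_i=0$ and $\sigma''X_i=0$ for all $i$. Then for every $p\ge 0$ the sequences $(\bigoplus_q\Omega_{p,q}(M),d'')$ and $(\bigoplus_q\mathcal V_{p,q}(M),\sigma'')$ are complexes of $I(M)$-modules ($d''\circ d''=0$, $\sigma''\circ\sigma''=0$), and they are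 isomorphic as complexes of $I(M)$-modules: there are $I(M)$-linear isomorphisms $e_q:\Omega_{p,q}(M)\to\mathcal V_{p,q}(M)$ with $e_{q+1}\circ d''=\sigma''\circ e_q$ for all $q\ge0$. In particular, for every $q\ge 0$, $$H^q(M,\mathcal P^p(\mathcal F))=\frac{\ker(d'':\Omega_{p,q}(M)\to\Omega_{p,q+1}(M))}{\operatorname{im}(d'':\Omega_{p,q-1}(M)\to\Omega_{p,q}(M))}$$ and the $q$-th cohomology of $(\bigoplus_k\mathcal V_{p,k}(M),\sigma'')$ are isomorphic $I(M)$-modules (the images being $0$ for $q=0$). -/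

import Mathlib

open scoped Manifold ContDiff

set_option linter.unusedSectionVars false

namespace TangentialPoisson

/-! ### Alternating cochains on a module with anchor and bracket -/

section Algebra

/-- A module `L` over a commutative `ℝ`-algebra `A` with an `A`-linear anchor into the derivations
of `A` and a skew-symmetric biadditive bracket satisfying the Leibniz rule
`[x, f y] = f [x, y] + (ρ(x) f) y`. It will be instantiated with the vector fields on a manifold
(anchor: the directional derivative, bracket: the Lie bracket) and with the `1`-forms on a Poisson
manifold (anchor: `α ↦ α^#`, bracket: the bracket of `1`-forms). -/
structure AnchoredBracket (A L : Type*) [CommRing A] [Algebra ℝ A] [AddCommGroup L]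
    [Module A L] where
  /-- The anchor. -/
  anchor : L →ₗ[A] Derivation ℝ A A
  /-- The bracket. -/
  bracket : L →+ L →+ L
  bracket_self : ∀ x, bracket x x = 0
  leibniz : ∀ (x y : L) (f : A), bracket x (f • y) = f • bracket x y + (anchor x f) • y

namespace AnchoredBracket

variable {A L : Type*} [CommRing A] [Algebra ℝ A] [AddCommGroup L] [Module A L]
  (K : AnchoredBracket A L)

/-- The sum `∑_{i < j} (-1)^(i+j) η([x_i, x_j], x_0, …, x̂_i, …, x̂_j, …, x_k)` for a `k`-cochain `η`.
For `k = n + 1`, pairs `i < j` in `Fin (n + 2)` are written as `(i.castSucc, j.succ)` with `i ≤ j` in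
`Fin (n + 1)`, which shifts the sign by one. -/
def bracketSum : {k : ℕ} → (L [⋀^Fin k]→ₗ[A] A) → (Fin (k + 1) → L) → A
  | 0, _, _ => 0
  | n + 1, η, x => - ∑ i : Fin (n + 1), ∑ j ∈ Finset.Ici i, (-1) ^ (i + j : ℕ) *
      η (Matrix.vecCons (K.bracket (x i.castSucc) (x j.succ))
        (j.removeNth (i.castSucc.removeNth x)))

/-- The Koszul formula
`∑_i (-1)^i ρ(x_i) (η(x_0, …, x̂_i, …, x_k))
  + ∑_{i < j} (-1)^(i+j) η([x_i, x_j], x_0, …, x̂_i, …, x̂_j, …, x_k)`. -/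
def koszulFun {k : ℕ} (η : L [⋀^Fin k]→ₗ[A] A) (x : Fin (k + 1) → L) : A :=
  ∑ i : Fin (k + 1), (-1) ^ (i : ℕ) * K.anchor (x i) (η (i.removeNth x)) + K.bracketSum η x

/-- An alternating map over `A`, seen as an alternating map over `ℤ`. -/
def toInt {k : ℕ} (η : L [⋀^Fin k]→ₗ[A] A) : L [⋀^Fin k]→ₗ[ℤ] A where
  toMultilinearMap := η.toMultilinearMap.restrictScalars ℤ
  map_eq_zero_of_eq' := η.map_eq_zero_of_eq'

@[simp] lemma toInt_apply {k : ℕ} (η : L [⋀^Fin k]→ₗ[A] A) (x : Fin k → L) :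
    toInt η x = η x := rfl

/-- The part of the Koszul formula containing the anchor, as an alternating map over `ℤ`. -/
noncomputable def anchorPart {k : ℕ} (η : L [⋀^Fin k]→ₗ[A] A) : L [⋀^Fin (k + 1)]→ₗ[ℤ] A :=
  AlternatingMap.alternatizeUncurryFin
    ({ toFun := fun x => ((K.anchor x : Derivation ℝ A A) : A →ₗ[ℝ] A).toAddMonoidHom.toIntLinearMap.compAlternatingMap
          (toInt η)
       map_add' := by intro x y; ext v; simp
       map_smul' := by intro c x; ext v; simp } : L →ₗ[ℤ] L [⋀^Fin k]→ₗ[ℤ] A)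

lemma anchorPart_apply {k : ℕ} (η : L [⋀^Fin k]→ₗ[A] A) (x : Fin (k + 1) → L) :
    K.anchorPart η x =
      ∑ i : Fin (k + 1), (-1) ^ (i : ℕ) * K.anchor (x i) (η (i.removeNth x)) := by
  simp [anchorPart, AlternatingMap.alternatizeUncurryFin_apply]

lemma bracket_swap (x y : L) : K.bracket x y = - K.bracket y x := by
  have h := K.bracket_self (x + y)
  simp only [map_add, AddMonoidHom.add_apply, K.bracket_self] at h
  rw [eq_neg_iff_add_eq_zero]
  simpa [add_comm] using h

lemma leibniz_left (x y : L) (f : A) :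
    K.bracket (f • x) y = f • K.bracket x y - (K.anchor y f) • x := by
  rw [bracket_swap, K.leibniz, K.bracket_swap x y]
  simp [smul_neg, sub_eq_add_neg]; abel

lemma exists_bracketPart : ∀ {k : ℕ} (η : L [⋀^Fin k]→ₗ[A] A),
    ∃ φ : L [⋀^Fin (k + 1)]→ₗ[ℤ] A, ∀ x, φ x = K.bracketSum η x
  | 0, η => ⟨0, fun x => rfl⟩
  | n + 1, η => by
    let f : L →ₗ[ℤ] L →ₗ[ℤ] L [⋀^Fin n]→ₗ[ℤ] A :=
      { toFun := fun x => (toInt η).curryLeft ∘ₗ (K.bracket x).toIntLinearMap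
        map_add' := by intro x y; ext; simp
        map_smul' := by intro x y; ext; simp }
    have hf : ∀ x y v, f x y v = η (Matrix.vecCons (K.bracket x y) v) := fun _ _ _ => rfl
    refine ⟨(-(1 / 2 : ℝ)) • AlternatingMap.alternatizeUncurryFin
      (AlternatingMap.alternatizeUncurryFinLM ∘ₗ f), fun x => ?_⟩
    rw [AlternatingMap.smul_apply,
      AlternatingMap.alternatizeUncurryFin_alternatizeUncurryFinLM_comp_apply]
    have h2 : ∀ x y v, f x y v - f y x v = (2 : ℝ) • f x y v := by
      intro x y v
      have : f y x v = - f x y v := by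
        rw [hf, hf, K.bracket_swap y x, ← neg_one_smul A (K.bracket x y)]
        rw [show (Matrix.vecCons ((-1 : A) • K.bracket x y) v) = Fin.cons ((-1 : A) • K.bracket x y) v from rfl]
        have := η.toMultilinearMap.cons_smul v (-1 : A) (K.bracket x y)
        rw [neg_one_smul] at this
        simpa using! this
      rw [this, two_smul]; abel
    simp only [h2, bracketSum]
    simp only [hf]
    rw [Finset.smul_sum, ← Finset.sum_neg_distrib]
    refine Finset.sum_congr rfl fun i _ => ?_
    rw [Finset.smul_sum, ← Finset.sum_neg_distrib]
    refine Finset.sum_congr rfl fun j _ => ?_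
    rw [smul_comm, smul_smul]
    norm_num [zsmul_eq_mul]

lemma removeNth_zero_cons {n : ℕ} (y : L) (z : Fin n → L) :
    (0 : Fin (n + 1)).removeNth (Fin.cons y z : Fin (n + 1) → L) = z := by
  ext i; simp [Fin.removeNth]

lemma removeNth_succ_cons {n : ℕ} (y : L) (z : Fin (n + 1) → L) (m : Fin (n + 1)) :
    m.succ.removeNth (Fin.cons y z : Fin (n + 2) → L) = Fin.cons y (m.removeNth z) := by
  ext i
  refine Fin.cases ?_ (fun i => ?_) i <;> simp [Fin.removeNth]

lemma map_cons_smul {k : ℕ} (η : L [⋀^Fin (k + 1)]→ₗ[A] A) (f : A) (y : L) (z : Fin k → L) :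
    η (Fin.cons (f • y) z) = f * η (Fin.cons y z) := by
  simpa using η.toMultilinearMap.cons_smul z f y

lemma map_cons_cons_smul {k : ℕ} (η : L [⋀^Fin (k + 2)]→ₗ[A] A) (f : A) (b y : L)
    (z : Fin k → L) :
    η (Matrix.vecCons b (Fin.cons (f • y) z)) = f * η (Matrix.vecCons b (Fin.cons y z)) :=
  map_cons_smul (η.curryLeft b) f y z

lemma koszulFun_cons_smul {k : ℕ} (η : L [⋀^Fin k]→ₗ[A] A) (f : A) (y : L) (z : Fin k → L) :
    K.koszulFun η (Fin.cons (f • y) z) = f * K.koszulFun η (Fin.cons y z) := by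
  cases k with
  | zero =>
    simp only [koszulFun, bracketSum, Fin.sum_univ_succ, Fin.cons_zero, removeNth_zero_cons,
      map_smul, Derivation.smul_apply, smul_eq_mul]
    simp
  | succ n =>
    simp only [koszulFun, bracketSum]
    rw [Fin.sum_univ_succ (n := n), Fin.sum_univ_succ (n := n), Fin.sum_univ_succ (n := n + 1),
      Fin.sum_univ_succ (n := n + 1)]
    have h1 : ∀ m : Fin (n + 1), (-1 : A) ^ (m.succ : ℕ) *
        K.anchor ((Fin.cons (f • y) z : Fin (n + 2) → L) m.succ)
          (η (m.succ.removeNth (Fin.cons (f • y) z : Fin (n + 2) → L))) =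
        f * ((-1 : A) ^ (m.succ : ℕ) * K.anchor ((Fin.cons y z : Fin (n + 2) → L) m.succ)
          (η (m.succ.removeNth (Fin.cons y z : Fin (n + 2) → L))))
        - (-1 : A) ^ (m : ℕ) * (K.anchor (z m) f * η (Fin.cons y (m.removeNth z))) := by
      intro m
      rw [removeNth_succ_cons, removeNth_succ_cons, map_cons_smul, Derivation.leibniz]
      simp only [Fin.cons_succ, smul_eq_mul, Fin.val_succ, pow_succ]
      ring
    have h2 : ∀ i : Fin n, ∀ j ∈ Finset.Ici i.succ, (-1 : A) ^ ((i.succ : ℕ) + (j : ℕ)) *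
        η (Matrix.vecCons (K.bracket ((Fin.cons (f • y) z : Fin (n + 2) → L) i.succ.castSucc)
          ((Fin.cons (f • y) z : Fin (n + 2) → L) j.succ))
          (j.removeNth (i.succ.castSucc.removeNth (Fin.cons (f • y) z : Fin (n + 2) → L)))) =
        f * ((-1 : A) ^ ((i.succ : ℕ) + (j : ℕ)) *
        η (Matrix.vecCons (K.bracket ((Fin.cons y z : Fin (n + 2) → L) i.succ.castSucc)
          ((Fin.cons y z : Fin (n + 2) → L) j.succ))
          (j.removeNth (i.succ.castSucc.removeNth (Fin.cons y z : Fin (n + 2) → L))))) := by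
      intro i j hj
      cases n with
      | zero => exact i.elim0
      | succ m =>
        obtain ⟨j, rfl⟩ : ∃ j', j = Fin.succ j' := by
          refine Fin.exists_succ_eq.2 ?_ |>.imp fun _ h => h.symm
          rintro rfl
          simp at hj
        rw [← Fin.succ_castSucc, removeNth_succ_cons, removeNth_succ_cons, removeNth_succ_cons,
          removeNth_succ_cons, map_cons_cons_smul]
        simp only [Fin.cons_succ]
        ring
    have h3 : ∀ j : Fin (n + 1), (-1 : A) ^ (((0 : Fin (n + 1)) : ℕ) + (j : ℕ)) *
        η (Matrix.vecCons (K.bracket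
          ((Fin.cons (f • y) z : Fin (n + 2) → L) (Fin.castSucc (0 : Fin (n + 1))))
          ((Fin.cons (f • y) z : Fin (n + 2) → L) j.succ))
          (j.removeNth ((Fin.castSucc (0 : Fin (n + 1))).removeNth
            (Fin.cons (f • y) z : Fin (n + 2) → L)))) =
        f * ((-1 : A) ^ (((0 : Fin (n + 1)) : ℕ) + (j : ℕ)) *
        η (Matrix.vecCons (K.bracket
          ((Fin.cons y z : Fin (n + 2) → L) (Fin.castSucc (0 : Fin (n + 1))))
          ((Fin.cons y z : Fin (n + 2) → L) j.succ))
          (j.removeNth ((Fin.castSucc (0 : Fin (n + 1))).removeNth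
            (Fin.cons y z : Fin (n + 2) → L)))))
        - (-1 : A) ^ (j : ℕ) * (K.anchor (z j) f * η (Fin.cons y (j.removeNth z))) := by
      intro j
      have e : ∀ u : L, Matrix.vecCons u (j.removeNth z) = Fin.cons u (j.removeNth z) :=
        fun _ => rfl
      have hsub : η (Fin.cons (K.bracket (f • y) (z j)) (j.removeNth z)) =
          f * η (Fin.cons (K.bracket y (z j)) (j.removeNth z)) -
            K.anchor (z j) f * η (Fin.cons y (j.removeNth z)) := by
        rw [K.leibniz_left, sub_eq_add_neg, ← neg_smul]
        have h := η.toMultilinearMap.cons_add (j.removeNth z) (f • K.bracket y (z j))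
          ((-K.anchor (z j) f) • y)
        simp only [AlternatingMap.coe_multilinearMap] at h
        rw [h, map_cons_smul, map_cons_smul]
        ring
      simp only [Fin.castSucc_zero, Fin.cons_zero, Fin.cons_succ, removeNth_zero_cons, e, hsub,
        Fin.val_zero, zero_add]
      ring
    rw [Finset.sum_congr rfl fun m _ => h1 m,
      Finset.sum_congr rfl fun i _ => Finset.sum_congr rfl (h2 i),
      Finset.sum_congr rfl fun j _ => h3 j]
    simp only [Finset.sum_sub_distrib, ← Finset.mul_sum]
    have h4 : (Finset.Ici (0 : Fin (n + 1))) = Finset.univ := by ext; simp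
    rw [h4]
    simp only [Fin.cons_zero, removeNth_zero_cons, map_smul, Derivation.smul_apply, smul_eq_mul]
    ring

/-- The Koszul differential of a `k`-cochain, given by the Koszul formula `koszulFun`. -/
noncomputable def koszul {k : ℕ} (η : L [⋀^Fin k]→ₗ[A] A) : L [⋀^Fin (k + 1)]→ₗ[A] A where
  toFun := K.koszulFun η
  map_update_add' := by
    classical
    intro _ x i a b
    obtain ⟨φ, hφ⟩ := K.exists_bracketPart η
    have h : ∀ x, K.koszulFun η x = (K.anchorPart η + φ) x := fun x => by
      simp [koszulFun, anchorPart_apply, hφ]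
    simp only [h]
    convert (K.anchorPart η + φ).map_update_add x i a b
  map_update_smul' := by
    classical
    intro inst x i f a
    obtain rfl : inst = instDecidableEqFin _ := Subsingleton.elim _ _
    obtain ⟨φ, hφ⟩ := K.exists_bracketPart η
    have h : ∀ x, K.koszulFun η x = (K.anchorPart η + φ) x := fun x => by
      simp [koszulFun, anchorPart_apply, hφ]
    have key : ∀ b : L, K.koszulFun η (Function.update x i b) =
        Equiv.Perm.sign (Equiv.swap 0 i) •
          K.koszulFun η (Fin.cons b (Fin.tail (Function.update x i b ∘ Equiv.swap 0 i))) := by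
      intro b
      have e : (Fin.cons b (Fin.tail (Function.update x i b ∘ Equiv.swap 0 i)) : Fin (k + 1) → L) =
          Function.update x i b ∘ Equiv.swap 0 i := by
        conv_rhs => rw [← Fin.cons_self_tail (Function.update x i b ∘ Equiv.swap 0 i)]
        simp
      rw [e, h, h, (K.anchorPart η + φ).map_perm, smul_smul, ← Equiv.Perm.sign_mul,
        Equiv.swap_mul_self, Equiv.Perm.sign_one, one_smul]
    have tl : ∀ b : L, Fin.tail (Function.update x i b ∘ Equiv.swap 0 i) =
        Fin.tail (Function.update x i 0 ∘ Equiv.swap 0 i) := by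
      intro b
      ext m
      have hm : Equiv.swap 0 i m.succ ≠ i := by
        intro hc
        have := (Equiv.swap 0 i).injective (hc.trans (Equiv.swap_apply_left 0 i).symm)
        exact Fin.succ_ne_zero m this
      simp [Fin.tail, Function.update_of_ne hm]
    rw [key, key, tl, tl a, koszulFun_cons_smul, smul_eq_mul, mul_smul_comm]
  map_eq_zero_of_eq' := by
    intro x i j hij hne
    obtain ⟨φ, hφ⟩ := K.exists_bracketPart η
    have h : ∀ x, K.koszulFun η x = (K.anchorPart η + φ) x := fun x => by
      simp [koszulFun, anchorPart_apply, hφ]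
    change K.koszulFun η x = 0
    rw [h]
    exact (K.anchorPart η + φ).map_eq_zero_of_eq x hij hne

/-! ### Bidegrees -/

/-- The cochains of degree `k` and of type `(p, k - p)` with respect to submodules `T` and `N`
(to be used with `L = T ⊕ N`): an alternating map of this type vanishes on all families in which the
arguments with index in `S` lie in `N` and the others lie in `T`, unless `S` has exactly `p`
elements. -/
def ofType (T N : Submodule A L) (p k : ℕ) : Submodule A (L [⋀^Fin k]→ₗ[A] A) where
  carrier := {η | ∀ S : Finset (Fin k), S.card ≠ p → ∀ x : Fin k → L,
    (∀ i ∈ S, x i ∈ N) → (∀ i ∉ S, x i ∈ T) → η x = 0}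
  zero_mem' := fun _ _ _ _ _ => rfl
  add_mem' := fun {η ζ} hη hζ S hS x hN hT => by
    rw [AlternatingMap.add_apply, hη S hS x hN hT, hζ S hS x hN hT, add_zero]
  smul_mem' := fun c η hη S hS x hN hT => by
    rw [AlternatingMap.smul_apply, hη S hS x hN hT, smul_zero]

/-- For `L = T ⊕ N`: project the arguments with index in `S` to `N` and the others to `T`. -/
noncomputable def mixed {T N : Submodule A L} (h : IsCompl T N) {k : ℕ} (S : Finset (Fin k))
    (x : Fin k → L) : Fin k → L :=
  fun i => if i ∈ S then N.projection T h.symm (x i) else T.projection N h (x i)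

lemma mixed_update {T N : Submodule A L} (h : IsCompl T N) {k : ℕ} (S : Finset (Fin k))
    (x : Fin k → L) (i : Fin k) (a : L) :
    mixed h S (Function.update x i a) = Function.update (mixed h S x) i
      (if i ∈ S then N.projection T h.symm a else T.projection N h a) := by
  ext m
  by_cases hm : m = i
  · subst hm; simp [mixed]
  · simp [mixed, hm]

lemma mixed_of_mem {T N : Submodule A L} (h : IsCompl T N) {k : ℕ} {S : Finset (Fin k)}
    (x : Fin k → L) {i : Fin k} (hi : i ∈ S) : mixed h S x i ∈ N := by
  simp [mixed, hi]

lemma mixed_of_notMem {T N : Submodule A L} (h : IsCompl T N) {k : ℕ} {S : Finset (Fin k)}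
    (x : Fin k → L) {i : Fin k} (hi : i ∉ S) : mixed h S x i ∈ T := by
  simp [mixed, hi]

lemma mixed_map_swap {T N : Submodule A L} (h : IsCompl T N) {k : ℕ} (S : Finset (Fin k))
    (x : Fin k → L) {i j : Fin k} (hx : x i = x j) :
    mixed h (S.map (Equiv.swap i j).toEmbedding) x = mixed h S x ∘ Equiv.swap i j := by
  ext m
  have hm : m ∈ S.map (Equiv.swap i j).toEmbedding ↔ Equiv.swap i j m ∈ S := by
    rw [Finset.mem_map_equiv, Equiv.symm_swap]
  have hxm : x (Equiv.swap i j m) = x m := by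
    by_cases h1 : m = i
    · subst h1; simp [hx]
    by_cases h2 : m = j
    · subst h2; simp [hx]
    rw [Equiv.swap_apply_of_ne_of_ne h1 h2]
  simp only [mixed, Function.comp_apply, hm, hxm]

lemma sum_mixed_eq_zero {T N : Submodule A L} (h : IsCompl T N) (p : ℕ) {k : ℕ}
    (η : L [⋀^Fin k]→ₗ[A] A) (x : Fin k → L) {i j : Fin k} (hx : x i = x j) (hij : i ≠ j) :
    ∑ S ∈ Finset.powersetCard p (Finset.univ : Finset (Fin k)), η (mixed h S x) = 0 := by
  refine Finset.sum_involution (fun S _ => S.map (Equiv.swap i j).toEmbedding) ?_ ?_ ?_ ?_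
  · intro S _
    rw [mixed_map_swap h S x hx, η.map_swap _ hij, add_neg_cancel]
  · intro S _ hS hSS
    apply hS
    have e := mixed_map_swap h S x hx
    rw [hSS] at e
    refine η.map_eq_zero_of_eq _ ?_ hij
    conv_lhs => rw [e]
    simp
  · intro S hS
    simpa using hS
  · intro S _
    ext m
    simp [Finset.mem_map_equiv]

/-- For `L = T ⊕ N`: the component of type `(p, k - p)` of a cochain of degree `k`. It is the sum,
over all choices of `p` among the `k` arguments, of the values of the cochain on the `N`-components
of the chosen arguments and the `T`-components of the others. -/
noncomputable def component {T N : Submodule A L} (h : IsCompl T N) (p : ℕ) {k : ℕ}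
    (η : L [⋀^Fin k]→ₗ[A] A) : L [⋀^Fin k]→ₗ[A] A where
  toFun x := ∑ S ∈ Finset.powersetCard p (Finset.univ : Finset (Fin k)), η (mixed h S x)
  map_update_add' := by
    intro inst x i a b
    obtain rfl : inst = instDecidableEqFin _ := Subsingleton.elim _ _
    rw [← Finset.sum_add_distrib]
    refine Finset.sum_congr rfl fun S _ => ?_
    rw [mixed_update, mixed_update, mixed_update, ← η.map_update_add]
    congr 2
    split_ifs <;> simp
  map_update_smul' := by
    intro inst x i c a
    obtain rfl : inst = instDecidableEqFin _ := Subsingleton.elim _ _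
    rw [Finset.smul_sum]
    refine Finset.sum_congr rfl fun S _ => ?_
    rw [mixed_update, mixed_update, ← η.map_update_smul]
    congr 2
    split_ifs <;> simp
  map_eq_zero_of_eq' x _ _ hx hij := sum_mixed_eq_zero h p η x hx hij

lemma component_apply {T N : Submodule A L} (h : IsCompl T N) (p : ℕ) {k : ℕ}
    (η : L [⋀^Fin k]→ₗ[A] A) (x : Fin k → L) :
    component h p η x =
      ∑ S ∈ Finset.powersetCard p (Finset.univ : Finset (Fin k)), η (mixed h S x) := rfl

lemma component_mem {T N : Submodule A L} (h : IsCompl T N) (p : ℕ) {k : ℕ}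
    (η : L [⋀^Fin k]→ₗ[A] A) : component h p η ∈ ofType T N p k := by
  intro S hS x hN hT
  rw [component_apply]
  refine Finset.sum_eq_zero fun S' hS' => ?_
  have hne : S' ≠ S := fun e => hS (e ▸ (Finset.mem_powersetCard.1 hS').2)
  obtain ⟨i, hi⟩ : ∃ i, ¬ (i ∈ S' ↔ i ∈ S) := by
    by_contra! hc
    exact hne (Finset.ext hc)
  refine η.map_coord_zero i ?_
  by_cases h1 : i ∈ S'
  · have h2 : i ∉ S := fun h2 => hi ⟨fun _ => h2, fun _ => h1⟩
    simp only [mixed, h1, if_true]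
    rw [Submodule.projection_apply, Submodule.projectionOnto_apply_of_mem_right h.symm (hT i h2)]
    rfl
  · have h2 : i ∈ S := by
      by_contra h2
      exact hi ⟨fun h => absurd h h1, fun h => absurd h h2⟩
    simp only [mixed, h1, if_false]
    rw [Submodule.projection_apply, Submodule.projectionOnto_apply_of_mem_right h (hN i h2)]
    rfl

lemma bracketSum_smul {k : ℕ} (f : A) (η : L [⋀^Fin k]→ₗ[A] A) (x : Fin (k + 1) → L) :
    K.bracketSum (f • η) x = f * K.bracketSum η x := by
  cases k with
  | zero => simp [bracketSum]
  | succ n =>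
    simp only [bracketSum, AlternatingMap.smul_apply, smul_eq_mul, mul_neg, Finset.mul_sum]
    congr 1
    refine Finset.sum_congr rfl fun i _ => Finset.sum_congr rfl fun j _ => by ring

lemma koszulFun_smul_mixed {T N : Submodule A L} (h : IsCompl T N) {p k : ℕ} {f : A}
    (hf : ∀ x ∈ T, K.anchor x f = 0) {η : L [⋀^Fin k]→ₗ[A] A} (hη : η ∈ ofType T N p k)
    {S : Finset (Fin (k + 1))} (hS : S.card = p) (x : Fin (k + 1) → L) :
    K.koszulFun (f • η) (mixed h S x) = f * K.koszulFun η (mixed h S x) := by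
  simp only [koszulFun, bracketSum_smul, mul_add, Finset.mul_sum]
  congr 1
  refine Finset.sum_congr rfl fun i _ => ?_
  rw [AlternatingMap.smul_apply, smul_eq_mul, Derivation.leibniz]
  have key : η (i.removeNth (mixed h S x)) * K.anchor (mixed h S x i) f = 0 := by
    by_cases hi : i ∈ S
    · have hcard : (Finset.univ.filter (fun m => i.succAbove m ∈ S)).card ≠ p := by
        have e : (Finset.univ.filter (fun m => i.succAbove m ∈ S)).map i.succAboveEmb =
            S.erase i := by
          ext m
          simp only [Finset.mem_map, Finset.mem_filter, Finset.mem_univ, true_and,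
            Finset.mem_erase]
          constructor
          · rintro ⟨a, ha, rfl⟩
            exact ⟨Fin.succAbove_ne i a, ha⟩
          · rintro ⟨hm, hmS⟩
            obtain ⟨a, rfl⟩ := Fin.exists_succAbove_eq hm
            exact ⟨a, hmS, rfl⟩
        have e2 := congrArg Finset.card e
        rw [Finset.card_map, Finset.card_erase_of_mem hi, hS] at e2
        have : 0 < S.card := Finset.card_pos.2 ⟨i, hi⟩
        omega
      rw [hη _ hcard _ ?_ ?_, zero_mul]
      · intro m hm
        exact mixed_of_mem h x (Finset.mem_filter.1 hm).2
      · intro m hm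
        refine mixed_of_notMem h x fun hc => hm ?_
        simpa using hc
    · rw [hf _ (mixed_of_notMem h x hi), mul_zero]
  simp only [smul_eq_mul, key, add_zero]
  ring

lemma koszul_apply {k : ℕ} (η : L [⋀^Fin k]→ₗ[A] A) (x : Fin (k + 1) → L) :
    K.koszul η x = K.koszulFun η x := rfl

lemma koszulFun_add {k : ℕ} (η ζ : L [⋀^Fin k]→ₗ[A] A) (x : Fin (k + 1) → L) :
    K.koszulFun (η + ζ) x = K.koszulFun η x + K.koszulFun ζ x := by
  have hb : K.bracketSum (η + ζ) x = K.bracketSum η x + K.bracketSum ζ x := by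
    cases k with
    | zero => simp [bracketSum]
    | succ n =>
      simp only [bracketSum, AlternatingMap.add_apply, mul_add, Finset.sum_add_distrib, neg_add]
  simp only [koszulFun, hb, AlternatingMap.add_apply, map_add, mul_add, Finset.sum_add_distrib]
  ring

/-- For `L = T ⊕ N` and a subalgebra `I` of `A` killed by the anchors of the elements of `T`: the
component of type `(0, 1)` of the Koszul differential on the cochains of type `(p, k - p)`, that is,
the component of type `(p, k + 1 - p)` of the Koszul differential of such a cochain. It is linear
over `I`. -/
noncomputable def leafDifferential {T N : Submodule A L} (h : IsCompl T N) (I : Subalgebra ℝ A)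
    (hI : ∀ f ∈ I, ∀ x ∈ T, K.anchor x f = 0) (p k : ℕ) :
    ofType T N p k →ₗ[I] ofType T N p (k + 1) where
  toFun η := ⟨component h p (K.koszul (η : L [⋀^Fin k]→ₗ[A] A)), component_mem h p _⟩
  map_add' η ζ := by
    ext x
    simp only [Submodule.coe_add, AlternatingMap.add_apply, component_apply, koszul_apply,
      koszulFun_add, Finset.sum_add_distrib]
  map_smul' f η := by
    ext x
    have e : ((f • η : ofType T N p k) : L [⋀^Fin k]→ₗ[A] A) = (f : A) • (η : L [⋀^Fin k]→ₗ[A] A) :=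
      rfl
    have e2 : ∀ θ : ofType T N p (k + 1),
        ((f • θ : ofType T N p (k + 1)) : L [⋀^Fin (k + 1)]→ₗ[A] A) x =
          (f : A) * (θ : L [⋀^Fin (k + 1)]→ₗ[A] A) x := fun _ => rfl
    rw [RingHom.id_apply, e2]
    simp only [e, component_apply, koszul_apply, Finset.mul_sum]
    refine Finset.sum_congr rfl fun S hS => ?_
    exact K.koszulFun_smul_mixed h (hI f f.2) η.2 (Finset.mem_powersetCard.1 hS).2 x

end AnchoredBracket

/-- The submodule of coboundaries `im (C^(q-1) → C^q)` of a sequence `C^0 → C^1 → C^2 → ⋯` of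
modules; it is `0` for `q = 0`. -/
def boundaries {R : Type*} [CommRing R] {C : ℕ → Type*} [∀ q, AddCommGroup (C q)]
    [∀ q, Module R (C q)] (d : ∀ q, C q →ₗ[R] C (q + 1)) : ∀ q, Submodule R (C q)
  | 0 => ⊥
  | q + 1 => LinearMap.range (d q)

/-- The `q`-th cohomology module `ker (C^q → C^(q+1)) / im (C^(q-1) → C^q)` of a complex. -/
abbrev Cohomology {R : Type*} [CommRing R] {C : ℕ → Type*} [∀ q, AddCommGroup (C q)]
    [∀ q, Module R (C q)] (d : ∀ q, C q →ₗ[R] C (q + 1)) (q : ℕ) : Type _ :=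
  LinearMap.ker (d q) ⧸ (boundaries d q).submoduleOf (LinearMap.ker (d q))

end Algebra

/-! ### Functions, vector fields and forms on a manifold -/

section Manifold

variable (E : Type*) [NormedAddCommGroup E] [NormedSpace ℝ E]
  (M : Type*) [TopologicalSpace M] [ChartedSpace E M]

/-- The algebra `C^∞(M)`. -/
abbrev SmoothFunctions : Type _ := C^∞⟮𝓘(ℝ, E), M; ℝ⟯

variable [IsManifold 𝓘(ℝ, E) ∞ M]

/-- The smooth vector fields on `M`. -/
abbrev VectorFields : Type _ :=
  Cₛ^∞⟮𝓘(ℝ, E); E, (TangentSpace 𝓘(ℝ, E) : M → Type _)⟯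

variable {E M}

noncomputable instance : SMul (SmoothFunctions E M) (VectorFields E M) :=
  ⟨fun f X => ⟨fun x => f x • X x, f.contMDiff.smul_section X.contMDiff⟩⟩

@[simp] lemma smul_vectorField_apply (f : SmoothFunctions E M) (X : VectorFields E M) (x : M) :
    (f • X) x = f x • X x := rfl

noncomputable instance : Module (SmoothFunctions E M) (VectorFields E M) where
  one_smul X := by ext x; simp
  mul_smul f g X := by ext x; simp [mul_smul]
  smul_zero f := by ext x; simp
  smul_add f X Y := by ext x; simp
  add_smul f g X := by ext x; simp [add_smul]
  zero_smul X := by ext x; simp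

variable [FiniteDimensional ℝ E]

lemma contMDiff_lieDeriv (X : VectorFields E M) (f : SmoothFunctions E M) :
    ContMDiff 𝓘(ℝ, E) 𝓘(ℝ, ℝ) ∞ (fun x => mvfderiv 𝓘(ℝ, E) f x (X x)) := by
  have h1 : ContMDiff 𝓘(ℝ, E).tangent 𝓘(ℝ, ℝ).tangent ∞ (tangentMap 𝓘(ℝ, E) 𝓘(ℝ, ℝ) f) :=
    f.contMDiff.contMDiff_tangentMap (by simp)
  have h2 := h1.comp X.contMDiff
  have h3 := (contMDiff_snd_tangentBundle_modelSpace ℝ 𝓘(ℝ, ℝ) (n := ∞)).comp h2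
  exact h3

/-- The directional derivative `X f` of a function along a vector field. -/
noncomputable def lieDeriv (X : VectorFields E M) (f : SmoothFunctions E M) :
    SmoothFunctions E M :=
  ⟨fun x => mvfderiv 𝓘(ℝ, E) f x (X x), contMDiff_lieDeriv X f⟩

lemma lieDeriv_apply (X : VectorFields E M) (f : SmoothFunctions E M) (x : M) :
    lieDeriv X f x = mvfderiv 𝓘(ℝ, E) f x (X x) := rfl

lemma mdifferentiableAt_fun (f : SmoothFunctions E M) (x : M) :
    MDifferentiableAt 𝓘(ℝ, E) 𝓘(ℝ, ℝ) f x :=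
  f.contMDiff.mdifferentiable (by simp) x

/-- The derivation `f ↦ X f` of `C^∞(M)` given by a vector field. -/
noncomputable def lieDerivation (X : VectorFields E M) :
    Derivation ℝ (SmoothFunctions E M) (SmoothFunctions E M) :=
  Derivation.mk'
    { toFun := lieDeriv X
      map_add' := fun f g => by
        ext x
        simp [lieDeriv_apply, mvfderiv_add (mdifferentiableAt_fun f x) (mdifferentiableAt_fun g x)]
      map_smul' := fun c f => by
        ext x
        have h := mvfderiv_smul (mdifferentiableAt_const (c := c) (I := 𝓘(ℝ, E)) (x := x))
          (mdifferentiableAt_fun f x)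
        have h2 := congrArg (fun φ => φ (X x)) h
        simp only [mvfderiv_const] at h2
        refine Eq.trans h2 ?_
        simp [lieDeriv_apply] }
    (fun f g => by
      ext x
      simp [lieDeriv_apply, mvfderiv_mul (mdifferentiableAt_fun f x) (mdifferentiableAt_fun g x)]
      )

/-- The Lie bracket of vector fields. -/
noncomputable def lieBracket (X Y : VectorFields E M) : VectorFields E M :=
  ⟨VectorField.mlieBracket 𝓘(ℝ, E) X Y, by
    have : IsManifold 𝓘(ℝ, E) (((⊤ : ℕ∞) : ℕ∞ω) + 1) M := by simpa
    have : IsManifold 𝓘(ℝ, E) (minSmoothness ℝ 2) M := by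
      rw [minSmoothness_of_isRCLikeNormedField]
      infer_instance
    have : CompleteSpace E := FiniteDimensional.complete ℝ E
    exact ContDiff.mlieBracket_vectorField (n := (⊤ : ℕ∞)) (m := (⊤ : ℕ∞)) X.contMDiff Y.contMDiff
      (by rw [minSmoothness_of_isRCLikeNormedField]; exact le_of_eq rfl)⟩

lemma lieBracket_apply (X Y : VectorFields E M) (x : M) :
    lieBracket X Y x = VectorField.mlieBracket 𝓘(ℝ, E) X Y x := rfl

variable (E M) in
/-- The vector fields on `M` with the directional derivative and the Lie bracket. -/
noncomputable def tangentBracket :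
    AnchoredBracket (SmoothFunctions E M) (VectorFields E M) where
  anchor :=
    { toFun := lieDerivation
      map_add' := fun X Y => by
        ext f x
        simp [lieDerivation, lieDeriv_apply]
      map_smul' := fun g X => by
        ext f x
        simp [lieDerivation, lieDeriv_apply] }
  bracket := AddMonoidHom.mk' (fun X => AddMonoidHom.mk' (lieBracket X) (fun Y Z => by
      ext x
      exact VectorField.mlieBracket_add_right Y.mdifferentiableAt Z.mdifferentiableAt))
    (fun X Y => by
      ext Z x
      exact VectorField.mlieBracket_add_left X.mdifferentiableAt Y.mdifferentiableAt)
  bracket_self := fun X => by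
    ext x
    exact congrFun VectorField.mlieBracket_self x
  leibniz := fun X Y f => by
    ext x
    have h := VectorField.mlieBracket_smul_right (I := 𝓘(ℝ, E)) (V := X) (W := Y)
      (mdifferentiableAt_fun f x) Y.mdifferentiableAt
    refine Eq.trans h ?_
    rw [add_comm]
    rfl

variable (E M)

/-- The differential `1`-forms on `M`, as `C^∞(M)`-linear maps from vector fields to functions. -/
abbrev OneForms : Type _ := Module.Dual (SmoothFunctions E M) (VectorFields E M)

/-- The differential forms of degree `k` on `M`, as alternating `C^∞(M)`-multilinear maps on
vector fields. -/
abbrev Forms (k : ℕ) : Type _ :=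
  VectorFields E M [⋀^Fin k]→ₗ[SmoothFunctions E M] SmoothFunctions E M

/-- The skew-symmetric contravariant tensor fields of degree `k` on `M`, as alternating
`C^∞(M)`-multilinear maps on `1`-forms. -/
abbrev Multivectors (k : ℕ) : Type _ :=
  OneForms E M [⋀^Fin k]→ₗ[SmoothFunctions E M] SmoothFunctions E M

variable {E M}

/-- The de Rham differential `d : Ω^k(M) → Ω^(k+1)(M)`. -/
noncomputable def deRham {k : ℕ} (η : Forms E M k) : Forms E M (k + 1) :=
  (tangentBracket E M).koszul η

/-- The differential `df` of a function. -/
noncomputable def differential (f : SmoothFunctions E M) : OneForms E M where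
  toFun X := lieDeriv X f
  map_add' X Y := by ext x; simp [lieDeriv_apply]
  map_smul' g X := by ext x; simp [lieDeriv_apply]

/-- The Lie derivative `L_X β` of a `1`-form: `(L_X β)(Y) = X(β(Y)) - β([X, Y])`. -/
noncomputable def lieDerivOneForm (X : VectorFields E M) (β : OneForms E M) : OneForms E M where
  toFun Y := lieDeriv X (β Y) - β (lieBracket X Y)
  map_add' Y Z := by
    have h1 := (lieDerivation X).map_add (β Y) (β Z)
    have h2 := ((tangentBracket E M).bracket X).map_add Y Z
    change lieDeriv X (β Y + β Z) = lieDeriv X (β Y) + lieDeriv X (β Z) at h1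
    change lieBracket X (Y + Z) = lieBracket X Y + lieBracket X Z at h2
    rw [map_add, h1, h2, map_add]
    abel
  map_smul' f Y := by
    have h1 := (lieDerivation X).leibniz f (β Y)
    have h2 := (tangentBracket E M).leibniz X Y f
    change lieDeriv X (f * β Y) = f * lieDeriv X (β Y) + β Y * lieDeriv X f at h1
    change lieBracket X (f • Y) = f • lieBracket X Y + lieDeriv X f • Y at h2
    rw [map_smul, smul_eq_mul, h1, h2, map_add, map_smul, map_smul]
    simp only [smul_eq_mul, RingHom.id_apply]
    ring

/-! ### Poisson manifolds -/

variable (E M) in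
/-- A Poisson structure on `M`, given by its Poisson bivector `Λ`. The bivector field is recorded by
its bundle map `# : T^*M → TM`, `β(α^#) = Λ(α, β)`, that is, by a `C^∞(M)`-linear map from `1`-forms
to vector fields which is skew-symmetric; the Jacobi identity is required of the bracket
`{f, g} = Λ(df, dg)` of functions. -/
structure PoissonStructure where
  /-- The map `α ↦ α^#`. -/
  sharp : OneForms E M →ₗ[SmoothFunctions E M] VectorFields E M
  skew : ∀ α β : OneForms E M, β (sharp α) = - α (sharp β)
  jacobi : ∀ f g h : SmoothFunctions E M,
    lieDeriv (sharp (differential (lieDeriv (sharp (differential f)) g))) h +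
    lieDeriv (sharp (differential (lieDeriv (sharp (differential g)) h))) f +
    lieDeriv (sharp (differential (lieDeriv (sharp (differential h)) f))) g = 0

namespace PoissonStructure

variable (P : PoissonStructure E M)

/-- The Poisson bivector, `Λ(α, β) = β(α^#)`. -/
noncomputable def bivector (α β : OneForms E M) : SmoothFunctions E M := β (P.sharp α)

/-- The bracket of `1`-forms, `{α, β} = L_{α^#} β - L_{β^#} α - d(Λ(α, β))`. -/
noncomputable def formBracket (α β : OneForms E M) : OneForms E M :=
  lieDerivOneForm (P.sharp α) β - lieDerivOneForm (P.sharp β) α - differential (P.bivector α β)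

lemma formBracket_apply (α β : OneForms E M) (Y : VectorFields E M) :
    P.formBracket α β Y =
      ((tangentBracket E M).anchor (P.sharp α) (β Y) -
        β ((tangentBracket E M).bracket (P.sharp α) Y)) -
      ((tangentBracket E M).anchor (P.sharp β) (α Y) -
        α ((tangentBracket E M).bracket (P.sharp β) Y)) -
      (tangentBracket E M).anchor Y (β (P.sharp α)) := rfl

/-- The `1`-forms on a Poisson manifold with the anchor `α ↦ α^#` and the bracket of `1`-forms. -/
noncomputable def cotangentBracket :
    AnchoredBracket (SmoothFunctions E M) (OneForms E M) where
  anchor := (tangentBracket E M).anchor ∘ₗ P.sharp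
  bracket := AddMonoidHom.mk' (fun α => AddMonoidHom.mk' (P.formBracket α) (fun β γ => by
      refine LinearMap.ext fun Y => ?_
      simp only [formBracket_apply, LinearMap.add_apply, map_add, AddMonoidHom.add_apply,
        Derivation.add_apply]
      abel))
    (fun α β => by
      refine AddMonoidHom.ext fun γ => LinearMap.ext fun Y => ?_
      simp only [formBracket_apply, LinearMap.add_apply, map_add, AddMonoidHom.add_apply,
        Derivation.add_apply, AddMonoidHom.mk'_apply]
      abel)
  bracket_self := fun α => by
    refine LinearMap.ext fun Y => ?_
    have h : α (P.sharp α) = 0 := by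
      have h1 := P.skew α α
      have h2 : (2 : ℝ) • α (P.sharp α) = 0 := by
        rw [two_smul]
        nth_rewrite 1 [h1]
        exact neg_add_cancel _
      exact (smul_eq_zero.1 h2).resolve_left two_ne_zero
    simp only [AddMonoidHom.mk'_apply, formBracket_apply, h, map_zero, sub_self,
      LinearMap.zero_apply]
  leibniz := fun α β f => by
    refine LinearMap.ext fun Y => ?_
    simp only [AddMonoidHom.mk'_apply, formBracket_apply, LinearMap.add_apply,
      LinearMap.smul_apply, map_smul, AnchoredBracket.leibniz_left, smul_eq_mul, map_sub,
      Derivation.smul_apply, Derivation.leibniz, LinearMap.comp_apply, P.skew α β]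
    ring

/-- The coboundary operator `σ = [Λ, ·]` on multivector fields, given by
`σQ(α_0, …, α_k) = ∑_i (-1)^i α_i^#(Q(α_0, …, α̂_i, …, α_k))
  + ∑_{i < j} (-1)^(i+j) Q({α_i, α_j}, α_0, …, α̂_i, …, α̂_j, …, α_k)`. -/
noncomputable def sigma {k : ℕ} (Q : Multivectors E M k) : Multivectors E M (k + 1) :=
  P.cotangentBracket.koszul Q

/-- The algebra `I(M)` of Casimir functions: the functions whose Hamiltonian vector field
vanishes. -/
noncomputable def casimirs : Subalgebra ℝ (SmoothFunctions E M) where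
  carrier := {f | P.sharp (differential f) = 0}
  mul_mem' := fun {f g} hf hg => by
    have e : differential (f * g) = f • differential g + g • differential f :=
      LinearMap.ext fun X => (lieDerivation X).leibniz f g
    have hf' : P.sharp (differential f) = 0 := hf
    have hg' : P.sharp (differential g) = 0 := hg
    change P.sharp (differential (f * g)) = 0
    rw [e, map_add, map_smul, map_smul, hf', hg', smul_zero, smul_zero, add_zero]
  add_mem' := fun {f g} hf hg => by
    have e : differential (f + g) = differential f + differential g :=
      LinearMap.ext fun X => (lieDerivation X).map_add f g
    have hf' : P.sharp (differential f) = 0 := hf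
    have hg' : P.sharp (differential g) = 0 := hg
    change P.sharp (differential (f + g)) = 0
    rw [e, map_add, hf', hg', add_zero]
  algebraMap_mem' := fun c => by
    have e : differential (algebraMap ℝ (SmoothFunctions E M) c) = 0 :=
      LinearMap.ext fun X => (lieDerivation X).map_algebraMap c
    change P.sharp (differential (algebraMap ℝ (SmoothFunctions E M) c)) = 0
    rw [e, map_zero]

/-- The tangent space `T_xF` at `x` of the leaf of the symplectic foliation through `x`: the image
of `#_x : T_x^*M → T_xM`. -/
noncomputable def leafTangent (x : M) : Submodule ℝ (TangentSpace 𝓘(ℝ, E) x) where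
  carrier := {v | ∃ α : OneForms E M, P.sharp α x = v}
  add_mem' := by
    rintro _ _ ⟨α, rfl⟩ ⟨β, rfl⟩
    exact ⟨α + β, by simp⟩
  zero_mem' := ⟨0, by simp⟩
  smul_mem' := by
    rintro c _ ⟨α, rfl⟩
    exact ⟨algebraMap ℝ (SmoothFunctions E M) c • α, by rw [map_smul]; rfl⟩

/-- `M` is regular: the rank of `#_x` does not depend on `x`. -/
def IsRegular : Prop :=
  ∃ r : ℕ, ∀ x : M, Module.finrank ℝ (P.leafTangent x) = r

/-- A transversal distribution `νF` for the symplectic foliation: a complement `ν_xF` of `T_xF` in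
`T_xM` at each point `x`, such that `TM = TF ⊕ νF` as smooth bundles, that is, both components of a
smooth vector field are smooth. -/
structure TransversalDistribution where
  /-- The subspace `ν_xF`. -/
  fiber : ∀ x : M, Submodule ℝ (TangentSpace 𝓘(ℝ, E) x)
  isCompl : ∀ x : M, IsCompl (P.leafTangent x) (fiber x)
  smooth : ∀ X : VectorFields E M, ∃ Y Z : VectorFields E M,
    X = Y + Z ∧ ∀ x : M, Y x ∈ P.leafTangent x ∧ Z x ∈ fiber x

/-- The vector fields tangent to the leaves: the sections of `TF`. -/
noncomputable def tangentFields : Submodule (SmoothFunctions E M) (VectorFields E M) where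
  carrier := {X | ∀ x : M, X x ∈ P.leafTangent x}
  add_mem' := fun hX hY x => (P.leafTangent x).add_mem (hX x) (hY x)
  zero_mem' := fun x => (P.leafTangent x).zero_mem
  smul_mem' := fun f _ hX x => (P.leafTangent x).smul_mem (f x) (hX x)

lemma tangent_kills_casimir {f : SmoothFunctions E M} (hf : f ∈ P.casimirs)
    {X : VectorFields E M} (hX : X ∈ P.tangentFields) : lieDeriv X f = 0 := by
  ext x
  obtain ⟨α, hα⟩ := hX x
  have hf' : P.sharp (differential f) = 0 := hf
  have h := P.skew α (differential f)
  rw [hf', map_zero, neg_zero] at h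
  have h2 := congrArg (fun g : SmoothFunctions E M => g x) h
  rw [lieDeriv_apply, ← hα]
  exact h2

namespace TransversalDistribution

variable {P} (ν : P.TransversalDistribution)

/-- The vector fields with values in the transversal distribution: the sections of `νF`. -/
noncomputable def normalFields : Submodule (SmoothFunctions E M) (VectorFields E M) where
  carrier := {X | ∀ x : M, X x ∈ ν.fiber x}
  add_mem' := fun hX hY x => (ν.fiber x).add_mem (hX x) (hY x)
  zero_mem' := fun x => (ν.fiber x).zero_mem
  smul_mem' := fun f _ hX x => (ν.fiber x).smul_mem (f x) (hX x)

lemma isCompl_fields : IsCompl P.tangentFields ν.normalFields := by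
  constructor
  · rw [Submodule.disjoint_def]
    intro X hT hN
    ext x
    exact Submodule.disjoint_def.1 (ν.isCompl x).disjoint (X x) (hT x) (hN x)
  · rw [Submodule.codisjoint_iff_exists_add_eq]
    intro X
    obtain ⟨Y, Z, h, hYZ⟩ := ν.smooth X
    exact ⟨Y, Z, fun x => (hYZ x).1, fun x => (hYZ x).2, h.symm⟩

/-- The `1`-forms vanishing on `νF`: the sections of `T^*F`, as a summand of
`T^*M = T^*F ⊕ ν^*F`. -/
noncomputable def tangentForms : Submodule (SmoothFunctions E M) (OneForms E M) :=
  ν.normalFields.dualAnnihilator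

/-- The `1`-forms vanishing on `TF`: the sections of `ν^*F`, as a summand of
`T^*M = T^*F ⊕ ν^*F`. -/
noncomputable def normalForms (_ν : P.TransversalDistribution) :
    Submodule (SmoothFunctions E M) (OneForms E M) :=
  P.tangentFields.dualAnnihilator

lemma isCompl_forms : IsCompl ν.tangentForms ν.normalForms := by
  constructor
  · rw [Submodule.disjoint_def]
    intro α hT hN
    refine LinearMap.ext fun X => ?_
    obtain ⟨Y, Z, h, hYZ⟩ := ν.smooth X
    have hY := (Submodule.mem_dualAnnihilator α).1 hN Y (fun x => (hYZ x).1)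
    have hZ := (Submodule.mem_dualAnnihilator α).1 hT Z (fun x => (hYZ x).2)
    rw [h, map_add, hY, hZ, add_zero, LinearMap.zero_apply]
  · rw [Submodule.codisjoint_iff_exists_add_eq]
    intro α
    refine ⟨α ∘ₗ P.tangentFields.projection ν.normalFields ν.isCompl_fields,
      α ∘ₗ ν.normalFields.projection P.tangentFields ν.isCompl_fields.symm, ?_, ?_, ?_⟩
    · refine (Submodule.mem_dualAnnihilator _).2 fun X hX => ?_
      rw [LinearMap.comp_apply, Submodule.projection_apply,
        Submodule.projectionOnto_apply_of_mem_right ν.isCompl_fields hX]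
      simp
    · refine (Submodule.mem_dualAnnihilator _).2 fun X hX => ?_
      rw [LinearMap.comp_apply, Submodule.projection_apply,
        Submodule.projectionOnto_apply_of_mem_right ν.isCompl_fields.symm hX]
      simp
    · refine LinearMap.ext fun X => ?_
      rw [LinearMap.add_apply, LinearMap.comp_apply, LinearMap.comp_apply, ← map_add]
      congr 1
      exact Submodule.projection_add_projection_eq_self ν.isCompl_fields X

/-- The space `Ω_{p,q}(M)` of forms of type `(p, q)`: the sections of
`∧^q(T^*F) ⊗ ∧^p(ν^*F)`, as forms of degree `p + q`. -/
noncomputable abbrev FormsOfType (p q : ℕ) : Submodule (SmoothFunctions E M) (Forms E M (p + q)) :=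
  AnchoredBracket.ofType P.tangentFields ν.normalFields p (p + q)

/-- The space `V_{p,q}(M)` of contravariant tensor fields of type `(p, q)`: the sections of
`∧^q(TF) ⊗ ∧^p(νF)`, as skew-symmetric tensor fields of degree `p + q`. -/
noncomputable abbrev MultivectorsOfType (p q : ℕ) :
    Submodule (SmoothFunctions E M) (Multivectors E M (p + q)) :=
  AnchoredBracket.ofType ν.tangentForms ν.normalForms p (p + q)

/-- The leafwise differential `d'' : Ω_{p,q}(M) → Ω_{p,q+1}(M)`: the part of type `(0, 1)` of the
de Rham differential. -/
noncomputable def dLeaf (p q : ℕ) : ν.FormsOfType p q →ₗ[P.casimirs] ν.FormsOfType p (q + 1) :=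
  (tangentBracket E M).leafDifferential ν.isCompl_fields P.casimirs
    (fun _ hf _ hX => P.tangent_kills_casimir hf hX) p (p + q)

/-- The operator `σ'' : V_{p,q}(M) → V_{p,q+1}(M)`: the part of type `(0, 1)` of `σ`. -/
noncomputable def sigmaLeaf (p q : ℕ) :
    ν.MultivectorsOfType p q →ₗ[P.casimirs] ν.MultivectorsOfType p (q + 1) :=
  P.cotangentBracket.leafDifferential ν.isCompl_forms P.casimirs
    (fun _ hf α _ => P.tangent_kills_casimir hf (fun _ => ⟨α, rfl⟩)) p (p + q)

/-- The cohomology `H^q(M, P^p(F)) = ker (d'' on Ω_{p,q}(M)) / d''(Ω_{p,q-1}(M))`. -/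
abbrev LeafCohomology (p q : ℕ) : Type _ :=
  Cohomology (R := P.casimirs) (C := fun k => ν.FormsOfType p k) (fun k => ν.dLeaf p k) q

/-- The `q`-th cohomology of the complex of the `V_{p,k}(M)`, `k ≥ 0`, with the operator `σ''`. -/
abbrev SigmaCohomology (p q : ℕ) : Type _ :=
  Cohomology (R := P.casimirs) (C := fun k => ν.MultivectorsOfType p k)
    (fun k => ν.sigmaLeaf p k) q

lemma dLeaf_coe (p q : ℕ) (η : ν.FormsOfType p q) :
    ((ν.dLeaf p q η : ν.FormsOfType p (q + 1)) : Forms E M (p + (q + 1))) =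
      AnchoredBracket.component ν.isCompl_fields p (deRham (η : Forms E M (p + q))) := rfl

lemma sigmaLeaf_coe (p q : ℕ) (Q : ν.MultivectorsOfType p q) :
    ((ν.sigmaLeaf p q Q : ν.MultivectorsOfType p (q + 1)) : Multivectors E M (p + (q + 1))) =
      AnchoredBracket.component ν.isCompl_forms p (P.sigma (Q : Multivectors E M (p + q))) := rfl

end TransversalDistribution

end PoissonStructure

end Manifold
end TangentialPoisson

open TangentialPoisson

namespace TangentialPoisson

namespace AnchoredBracket

variable {A L : Type*} [CommRing A] [Algebra ℝ A] [AddCommGroup L] [Module A L]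
  (K : AnchoredBracket A L)

/-! ### Cartan calculus -/

/-! Both complexes consist of alternating maps with a differential given by the same Koszul formula,
so they can be matched by precomposition with one `C^∞(M)`-linear isomorphism Φ from 1-forms to
vector fields: e(η)(α_1, …, α_k) = η(Φα_1, …, Φα_k). On T^*F take Φ = #, which maps the sections of
T^*F onto those of TF because P is regular (`exists_sharp_eq`). On ν^*F take the map into νF
determined by β_j(Φα) = X_j(α) for all j; then e turns each β_j into X_j. The sum of the two is
`formsToFields`.

To compare e(d''η) with σ''(eη), evaluate on p normal and q+1 tangent arguments. Since η vanishes
unless exactly p of its arguments are normal, the Koszul formula only sees the anchors of tangent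
arguments, brackets of two tangent arguments modulo normal ones, and brackets of a tangent with a
normal argument modulo tangent ones (`koszul_compLinearMap_of_hasLabels`). Φ preserves these data.
For two tangent arguments this holds because # is a morphism of brackets, which is the Jacobi
identity of P (`sharp_formBracket`). For mixed ones, d''β_j = 0 and σ''X_j = 0 mean β_j([Y, Z]) =
Y(β_j(Z)) and X_j({α, γ}) = α^#(X_j(γ)) for Y, α tangent and Z, γ normal
(`anchor_eq_of_leafDifferential_eq_zero`), hence every β_j kills Φ{α, γ} − [Φα, Φγ]
(`formsToFields_bracket_normal`).

For d''² = 0: d² = 0 by Cartan calculus (`koszul_koszul`), TF is involutive, so d respects the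
filtration by the number of normal arguments, and d'' is d modulo the next filtration step
(`component_koszul_component_koszul`). Then σ''² = 0 is transported along e, so the Jacobi identity
for the bracket of 1-forms is never needed. -/

lemma koszul_add {k : ℕ} (η ζ : L [⋀^Fin k]→ₗ[A] A) :
    K.koszul (η + ζ) = K.koszul η + K.koszul ζ :=
  AlternatingMap.ext fun x => K.koszulFun_add η ζ x

lemma koszul_sub {k : ℕ} (η ζ : L [⋀^Fin k]→ₗ[A] A) :
    K.koszul (η - ζ) = K.koszul η - K.koszul ζ := by
  rw [eq_sub_iff_add_eq, ← koszul_add, sub_add_cancel]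

lemma koszul_apply_zero (η : L [⋀^Fin 0]→ₗ[A] A) (x : L) (y : Fin 0 → L) :
    K.koszul η (Fin.cons x y) = K.anchor x (η y) := by
  have : ∀ i : Fin 1, η (i.removeNth (Fin.cons x y : Fin 1 → L)) = η y := fun i =>
    congrArg η (Subsingleton.elim _ _)
  simp [koszul_apply, koszulFun, bracketSum, this]

lemma map_cons_cons_swap {k : ℕ} (η : L [⋀^Fin (k + 2)]→ₗ[A] A) (a b : L) (z : Fin k → L) :
    η (Fin.cons a (Fin.cons b z)) = - η (Fin.cons b (Fin.cons a z)) := by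
  have h := η.map_swap (Fin.cons b (Fin.cons a z)) (i := 0) (j := 1) (by simp)
  rw [← h]
  congr 1
  ext m
  refine Fin.cases ?_ (fun m => ?_) m
  · simp only [Function.comp_apply, Equiv.swap_apply_left]
    rfl
  · refine Fin.cases ?_ (fun m => ?_) m
    · simp
    · have h1 : m.succ.succ ≠ (1 : Fin (k + 2)) := by
        simp [Fin.ext_iff]
      simp [Equiv.swap_apply_of_ne_of_ne (Fin.succ_ne_zero _) h1]

lemma curryLeft_sub_apply {k : ℕ} (η ζ : L [⋀^Fin (k + 1)]→ₗ[A] A) (x : L) :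
    (η - ζ).curryLeft x = η.curryLeft x - ζ.curryLeft x := rfl

/-- The pairs (0, j) give the first sum. In the remaining pairs, moving x past the bracket into the
first slot costs a sign and leaves the bracket sum of the contraction of η with x. -/
lemma bracketSum_cons_succ {k : ℕ} (η : L [⋀^Fin (k + 1)]→ₗ[A] A) (x : L) (y : Fin (k + 1) → L) :
    K.bracketSum η (Fin.cons x y) =
      - ∑ j : Fin (k + 1), (-1) ^ (j : ℕ) * η (Fin.cons (K.bracket x (y j)) (j.removeNth y))
      - K.bracketSum (η.curryLeft x) y := by
  have h0 : (Finset.Ici (0 : Fin (k + 1))) = Finset.univ := by ext; simp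
  rw [bracketSum, Fin.sum_univ_succ, h0, neg_add, sub_eq_add_neg]
  congr 1
  · congr 1
    refine Finset.sum_congr rfl fun j _ => ?_
    simp [Matrix.vecCons]
  · cases k with
    | zero => simp [bracketSum]
    | succ k =>
      rw [bracketSum, neg_neg, ← Finset.sum_neg_distrib]
      refine Finset.sum_congr rfl fun i _ => ?_
      have hI : Finset.Ici i.succ = (Finset.Ici i).map (Fin.succEmb _) := by
        ext m
        refine Fin.cases ?_ (fun m => ?_) m <;> simp [Fin.succ_ne_zero]
      rw [hI, Finset.sum_map, ← Finset.sum_neg_distrib]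
      refine Finset.sum_congr rfl fun j _ => ?_
      simp only [Fin.coe_succEmb]
      rw [← Fin.succ_castSucc, removeNth_succ_cons, removeNth_succ_cons]
      simp only [Matrix.vecCons, Fin.cons_succ, Fin.val_succ]
      rw [map_cons_cons_swap]
      simp only [AlternatingMap.curryLeft_apply_apply, Matrix.vecCons]
      ring

/-- This is Cartan's formula i_x d = L_x − d i_x with L_x written out; it turns statements about d
into inductions on the degree. -/
lemma koszul_cons_succ {k : ℕ} (η : L [⋀^Fin (k + 1)]→ₗ[A] A) (x : L) (y : Fin (k + 1) → L) :
    K.koszul η (Fin.cons x y) = K.anchor x (η y) -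
      ∑ j : Fin (k + 1), (-1) ^ (j : ℕ) * η (Fin.cons (K.bracket x (y j)) (j.removeNth y)) -
      K.koszul (η.curryLeft x) y := by
  simp only [koszul_apply, koszulFun, bracketSum_cons_succ]
  rw [Fin.sum_univ_succ]
  simp only [Fin.cons_zero, removeNth_zero_cons, Fin.cons_succ, removeNth_succ_cons, Fin.val_succ,
    Fin.val_zero, pow_zero, one_mul, AlternatingMap.curryLeft_apply_apply, Matrix.vecCons]
  simp only [pow_succ, mul_neg, mul_one, neg_mul, Finset.sum_neg_distrib]
  ring

/-- The Lie derivative of a cochain along an element, `L_x = i_x d + d i_x`. -/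
noncomputable def lieDer (x : L) : {k : ℕ} → (L [⋀^Fin k]→ₗ[A] A) → (L [⋀^Fin k]→ₗ[A] A)
  | 0, η => (K.koszul η).curryLeft x
  | _ + 1, η => (K.koszul η).curryLeft x + K.koszul (η.curryLeft x)

lemma lieDer_add (x : L) {k : ℕ} (η ζ : L [⋀^Fin k]→ₗ[A] A) :
    K.lieDer x (η + ζ) = K.lieDer x η + K.lieDer x ζ := by
  cases k with
  | zero => simp [lieDer, koszul_add]
  | succ k => simp only [lieDer, koszul_add, AlternatingMap.curryLeft_add, LinearMap.add_apply]; abel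

lemma lieDer_sub (x : L) {k : ℕ} (η ζ : L [⋀^Fin k]→ₗ[A] A) :
    K.lieDer x (η - ζ) = K.lieDer x η - K.lieDer x ζ := by
  rw [eq_sub_iff_add_eq, ← lieDer_add, sub_add_cancel]

lemma lieDer_apply_zero (x : L) (η : L [⋀^Fin 0]→ₗ[A] A) (y : Fin 0 → L) :
    K.lieDer x η y = K.anchor x (η y) :=
  K.koszul_apply_zero η x y

lemma lieDer_apply_succ (x : L) {k : ℕ} (η : L [⋀^Fin (k + 1)]→ₗ[A] A) (y : Fin (k + 1) → L) :
    K.lieDer x η y = K.anchor x (η y) -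
      ∑ j : Fin (k + 1), (-1) ^ (j : ℕ) * η (Fin.cons (K.bracket x (y j)) (j.removeNth y)) := by
  have h := K.koszul_cons_succ η x y
  rw [lieDer, AlternatingMap.add_apply, AlternatingMap.curryLeft_apply_apply, Matrix.vecCons, h]
  ring

/-- The commutation rule i_y L_x = L_x i_y − i_[x,y], the inductive step for the identities below.
-/
lemma curryLeft_lieDer (x y : L) {k : ℕ} (η : L [⋀^Fin (k + 1)]→ₗ[A] A) :
    (K.lieDer x η).curryLeft y = K.lieDer x (η.curryLeft y) - η.curryLeft (K.bracket x y) := by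
  ext z
  rw [AlternatingMap.curryLeft_apply_apply, Matrix.vecCons, lieDer_apply_succ, Fin.sum_univ_succ,
    AlternatingMap.sub_apply]
  cases k with
  | zero =>
    rw [lieDer_apply_zero]
    simp [Matrix.vecCons]
  | succ k =>
    rw [lieDer_apply_succ]
    simp only [Fin.cons_zero, removeNth_zero_cons, Fin.cons_succ, removeNth_succ_cons, Fin.val_succ,
      Fin.val_zero, pow_zero, one_mul, AlternatingMap.curryLeft_apply_apply, Matrix.vecCons]
    simp only [map_cons_cons_swap η _ y, pow_succ, mul_neg, mul_one, neg_mul, neg_neg]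
    ring

/-- The Jacobi identity and the compatibility of the anchor with the brackets. -/
structure IsLie : Prop where
  jacobi : ∀ x y z, K.bracket (K.bracket x y) z =
    K.bracket x (K.bracket y z) - K.bracket y (K.bracket x z)
  anchor_bracket : ∀ x y f, K.anchor (K.bracket x y) f =
    K.anchor x (K.anchor y f) - K.anchor y (K.anchor x f)

lemma ext_curryLeft {k : ℕ} {η ζ : L [⋀^Fin (k + 1)]→ₗ[A] A}
    (h : ∀ x, η.curryLeft x = ζ.curryLeft x) : η = ζ := by
  ext v
  rw [← Fin.cons_self_tail v]
  exact congrArg (fun θ : L [⋀^Fin k]→ₗ[A] A => θ (Fin.tail v)) (h (v 0))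

variable {K}

/-- Induction on the degree by contracting with z: degree 0 is the compatibility of anchor and
bracket, and the terms η([·,[·,z]]) produced in the step cancel by the Jacobi identity. -/
lemma IsLie.lieDer_bracket (hK : K.IsLie) (x y : L) : ∀ {k : ℕ} (η : L [⋀^Fin k]→ₗ[A] A),
    K.lieDer (K.bracket x y) η = K.lieDer x (K.lieDer y η) - K.lieDer y (K.lieDer x η)
  | 0, η => by
    ext z
    simp only [AlternatingMap.sub_apply, lieDer_apply_zero, hK.anchor_bracket]
  | k + 1, η => by
    refine ext_curryLeft fun z => ?_
    simp only [curryLeft_sub_apply, curryLeft_lieDer, lieDer_sub,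
      hK.lieDer_bracket x y (η.curryLeft z), hK.jacobi x y z, map_sub]
    abel

lemma curryLeft_koszul (x : L) {k : ℕ} (η : L [⋀^Fin (k + 1)]→ₗ[A] A) :
    (K.koszul η).curryLeft x = K.lieDer x η - K.koszul (η.curryLeft x) := by
  rw [lieDer, add_sub_cancel_right]

/-- After contraction with y, L_x d = d L_x reduces to L_[x,y] = L_x L_y − L_y L_x and to the same
identity for i_y η, of lower degree. -/
lemma IsLie.lieDer_koszul (hK : K.IsLie) (x : L) : ∀ {k : ℕ} (η : L [⋀^Fin k]→ₗ[A] A),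
    K.lieDer x (K.koszul η) = K.koszul (K.lieDer x η)
  | 0, η => by
    refine ext_curryLeft fun y => ?_
    have h : ∀ z (ζ : L [⋀^Fin 0]→ₗ[A] A), (K.koszul ζ).curryLeft z = K.lieDer z ζ :=
      fun _ _ => rfl
    rw [curryLeft_lieDer, h, h, h, hK.lieDer_bracket]
    abel
  | k + 1, η => by
    refine ext_curryLeft fun y => ?_
    simp only [curryLeft_lieDer, curryLeft_koszul, lieDer_sub, koszul_sub, hK.lieDer_bracket,
      hK.lieDer_koszul x (η.curryLeft y)]
    abel

/-- i_x ddη = L_x dη − d(L_x η − d i_x η) = dd i_x η, which vanishes by induction on the degree. -/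
lemma IsLie.koszul_koszul (hK : K.IsLie) : ∀ {k : ℕ} (η : L [⋀^Fin k]→ₗ[A] A),
    K.koszul (K.koszul η) = 0
  | 0, η => by
    refine ext_curryLeft fun x => ?_
    have h : (K.koszul η).curryLeft x = K.lieDer x η := rfl
    rw [curryLeft_koszul, h, hK.lieDer_koszul, sub_self]
    simp
  | k + 1, η => by
    refine ext_curryLeft fun x => ?_
    rw [curryLeft_koszul, curryLeft_koszul, koszul_sub, hK.lieDer_koszul,
      hK.koszul_koszul (η.curryLeft x)]
    simp

end AnchoredBracket
namespace AnchoredBracket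

variable {A L : Type*} [CommRing A] [Algebra ℝ A] [AddCommGroup L] [Module A L]
  (K : AnchoredBracket A L)

/-! ### Families with prescribed types -/

/-- The arguments with label `true` lie in `N` and those with label `false` in `T`. -/
def HasLabels (T N : Submodule A L) {k : ℕ} (l : Fin k → Bool) (x : Fin k → L) : Prop :=
  ∀ i, x i ∈ bif l i then N else T

/-- The number of labels `true`. -/
def labelCount {k : ℕ} (l : Fin k → Bool) : ℕ := ∑ i, (l i).toNat

variable {T N : Submodule A L}

lemma labelCount_removeNth {k : ℕ} (l : Fin (k + 1) → Bool) (i : Fin (k + 1)) :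
    labelCount l = (l i).toNat + labelCount (i.removeNth l) := by
  rw [labelCount, Fin.sum_univ_succAbove _ i]; rfl

lemma labelCount_cons {k : ℕ} (b : Bool) (l : Fin k → Bool) :
    labelCount (Fin.cons b l : Fin (k + 1) → Bool) = b.toNat + labelCount l := by
  simp [labelCount, Fin.sum_univ_succ]

lemma HasLabels.removeNth {k : ℕ} {l : Fin (k + 1) → Bool} {x : Fin (k + 1) → L}
    (h : HasLabels T N l x) (i : Fin (k + 1)) : HasLabels T N (i.removeNth l) (i.removeNth x) :=
  fun _ => h _

lemma HasLabels.cons {k : ℕ} {l : Fin k → Bool} {x : Fin k → L} (h : HasLabels T N l x)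
    {b : Bool} {y : L} (hy : y ∈ bif b then N else T) :
    HasLabels T N (Fin.cons b l : Fin (k + 1) → Bool) (Fin.cons y x : Fin (k + 1) → L) :=
  fun i => Fin.cases hy h i

lemma labelCount_decide {k : ℕ} (S : Finset (Fin k)) :
    labelCount (fun i => decide (i ∈ S)) = S.card := by
  have h : ∀ i, (decide (i ∈ S)).toNat = if i ∈ S then 1 else 0 := fun i => by
    by_cases hi : i ∈ S <;> simp [hi]
  simp [labelCount, h]

lemma labelCount_eq_card {k : ℕ} (l : Fin k → Bool) :
    labelCount l = (Finset.univ.filter fun i => l i = true).card := by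
  rw [← labelCount_decide]
  simp

/-- Labels replace the subsets S because they pass through `Fin.cons` and `removeNth`; counting
normal arguments after a bracket then becomes arithmetic. -/
lemma mem_ofType_iff {p k : ℕ} {η : L [⋀^Fin k]→ₗ[A] A} :
    η ∈ ofType T N p k ↔
      ∀ (l : Fin k → Bool) (x : Fin k → L), HasLabels T N l x → labelCount l ≠ p → η x = 0 := by
  constructor
  · intro h l x hx hl
    rw [labelCount_eq_card] at hl
    refine h _ hl x (fun i hi => ?_) (fun i hi => ?_)
    · have := hx i
      simp only [Finset.mem_filter, Finset.mem_univ, true_and] at hi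
      rwa [hi] at this
    · have := hx i
      simp only [Finset.mem_filter, Finset.mem_univ, true_and, Bool.not_eq_true] at hi
      rwa [hi] at this
  · intro h S hS x hN hT
    refine h (fun i => decide (i ∈ S)) x (fun i => ?_) (by rwa [labelCount_decide])
    by_cases hi : i ∈ S
    · simpa [hi] using hN i hi
    · simpa [hi] using hT i hi

lemma hasLabels_mixed (h : IsCompl T N) {k : ℕ} (S : Finset (Fin k)) (x : Fin k → L) :
    HasLabels T N (fun i => decide (i ∈ S)) (mixed h S x) := fun i => by
  by_cases hi : i ∈ S
  · simpa [hi] using mixed_of_mem h x hi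
  · simpa [hi] using mixed_of_notMem h x hi

lemma removeNth_castSucc_apply {X : Type*} {n : ℕ} (v : Fin (n + 2) → X) {i j : Fin (n + 1)}
    (h : i ≤ j) : i.castSucc.removeNth v j = v j.succ := by
  simp [Fin.removeNth_apply, Fin.succAbove_of_le_castSucc, h]

lemma labelCount_removeNth_removeNth {n : ℕ} (l : Fin (n + 2) → Bool) {i j : Fin (n + 1)}
    (h : i ≤ j) : labelCount l = (l i.castSucc).toNat + (l j.succ).toNat +
      labelCount (j.removeNth (i.castSucc.removeNth l)) := by
  rw [labelCount_removeNth l i.castSucc, labelCount_removeNth (i.castSucc.removeNth l) j,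
    ← add_assoc, ← removeNth_castSucc_apply l h]

lemma map_cons_add {k : ℕ} (η : L [⋀^Fin (k + 1)]→ₗ[A] A) (a b : L) (z : Fin k → L) :
    η (Fin.cons (a + b) z) = η (Fin.cons a z) + η (Fin.cons b z) := by
  simpa using η.toMultilinearMap.cons_add z a b

/-! ### The filtration by the number of normal arguments -/

/-- The cochains vanishing on all families with less than `p` arguments in `N` and the others
in `T`. -/
def InFiltration (T N : Submodule A L) (p : ℕ) {k : ℕ} (η : L [⋀^Fin k]→ₗ[A] A) : Prop :=
  ∀ (l : Fin k → Bool) (x : Fin k → L), HasLabels T N l x → labelCount l < p → η x = 0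

/-- No term of the Koszul formula can raise the number of normal arguments. Only a bracket of two
tangent arguments could, and involutivity of T excludes that. -/
lemma InFiltration.koszul (h : IsCompl T N) (hT : ∀ x ∈ T, ∀ y ∈ T, K.bracket x y ∈ T) {p k : ℕ}
    {η : L [⋀^Fin k]→ₗ[A] A} (hη : InFiltration T N p η) : InFiltration T N p (K.koszul η) := by
  intro l x hx hl
  rw [koszul_apply, koszulFun]
  have h1 : ∀ i : Fin (k + 1), η (i.removeNth x) = 0 := fun i =>
    hη _ _ (hx.removeNth i) (by have := labelCount_removeNth l i; omega)
  have h2 : K.bracketSum η x = 0 := by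
    cases k with
    | zero => rfl
    | succ n =>
      rw [bracketSum, neg_eq_zero]
      refine Finset.sum_eq_zero fun i _ => Finset.sum_eq_zero fun j hj => ?_
      have hij : i ≤ j := Finset.mem_Ici.1 hj
      have hc := labelCount_removeNth_removeNth l hij
      have hr := (hx.removeNth i.castSucc).removeNth j
      have key : η (Fin.cons (K.bracket (x i.castSucc) (x j.succ))
          (j.removeNth (i.castSucc.removeNth x))) = 0 := by
        by_cases hb : l i.castSucc = false ∧ l j.succ = false
        · refine hη _ _ (hr.cons (b := false) ?_) ?_
          · have hi := hx i.castSucc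
            have hj := hx j.succ
            rw [hb.1] at hi
            rw [hb.2] at hj
            exact hT _ hi _ hj
          · rw [labelCount_cons]
            simp only [Bool.toNat_false]
            omega
        -- At least one normal argument is used up by the bracket, so even if the bracket
        -- contributes a normal component the count stays below p.
        · have hb' : 1 ≤ (l i.castSucc).toNat + (l j.succ).toNat := by
            cases h1 : l i.castSucc <;> cases h2 : l j.succ <;> simp_all
          obtain ⟨t, n, ht, hn, hb⟩ := Submodule.codisjoint_iff_exists_add_eq.1 h.codisjoint
            (K.bracket (x i.castSucc) (x j.succ))
          rw [← hb, map_cons_add, hη _ _ (hr.cons (b := false) ht),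
            hη _ _ (hr.cons (b := true) hn), add_zero]
          · rw [labelCount_cons, Bool.toNat_true]; omega
          · rw [labelCount_cons, Bool.toNat_false]; omega
      rw [Matrix.vecCons, key, mul_zero]
  rw [h2, add_zero]
  refine Finset.sum_eq_zero fun i _ => ?_
  rw [h1, map_zero, mul_zero]

lemma component_eq_zero_of_inFiltration (h : IsCompl T N) {p k : ℕ} {η : L [⋀^Fin k]→ₗ[A] A}
    (hη : InFiltration T N (p + 1) η) : component h p η = 0 := by
  ext x
  rw [component_apply]
  refine Finset.sum_eq_zero fun S hS => hη _ _ (hasLabels_mixed h S x) ?_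
  rw [labelCount_decide, (Finset.mem_powersetCard.1 hS).2]
  omega

lemma mixed_eq_self (h : IsCompl T N) {k : ℕ} {S : Finset (Fin k)} {x : Fin k → L}
    (hx : HasLabels T N (fun i => decide (i ∈ S)) x) : mixed h S x = x := by
  ext i
  have := hx i
  by_cases hi : i ∈ S
  · simp only [hi, decide_true, cond_true] at this
    simp only [mixed, hi, if_true]
    rw [Submodule.projection_apply, Submodule.projectionOnto_apply_of_mem_left h.symm this]
  · simp only [hi, decide_false, cond_false] at this
    simp only [mixed, hi, if_false]
    rw [Submodule.projection_apply, Submodule.projectionOnto_apply_of_mem_left h this]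

lemma mixed_eq_zero_of_mem_of_notMem (h : IsCompl T N) {k : ℕ} {S : Finset (Fin k)}
    {x : Fin k → L} {i : Fin k} (hi : i ∈ S) (hx : x i ∈ T) : mixed h S x i = 0 := by
  simp only [mixed, hi, if_true]
  rw [Submodule.projection_apply, Submodule.projectionOnto_apply_of_mem_right h.symm hx]
  rfl

lemma component_apply_of_hasLabels (h : IsCompl T N) {p k : ℕ} (η : L [⋀^Fin k]→ₗ[A] A)
    {l : Fin k → Bool} {x : Fin k → L} (hx : HasLabels T N l x) (hl : labelCount l = p) :
    component h p η x = η x := by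
  set S₀ : Finset (Fin k) := Finset.univ.filter fun i => l i = true with hS₀
  have hl' : l = fun i => decide (i ∈ S₀) := by
    ext i; simp [hS₀]
  have hcard : S₀.card = p := by rw [← hl, labelCount_eq_card]
  rw [component_apply, Finset.sum_eq_single S₀]
  · rw [mixed_eq_self h (by rwa [← hl'])]
  -- Another S of the same size contains an index whose argument is tangent, and the projection to N
  -- kills that argument.
  · intro S hS hne
    obtain ⟨i, hi, hi'⟩ : ∃ i ∈ S, i ∉ S₀ := by
      by_contra! hc
      exact hne (Finset.eq_of_subset_of_card_le hc
        (by rw [hcard, (Finset.mem_powersetCard.1 hS).2]))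
    refine η.map_coord_zero i (mixed_eq_zero_of_mem_of_notMem h hi ?_)
    have := hx i
    rw [hl'] at this
    simpa [hi'] using this
  · intro hS
    exact absurd (Finset.mem_powersetCard.2 ⟨Finset.subset_univ _, hcard⟩) hS

/-- Write D for the Koszul differential. Dη lies in filtration step p, so its component of type p
differs from it by an element of step p + 1. D keeps that error in step p + 1, where the component
of type p is zero, and what remains is the component of D²η = 0. -/
lemma component_koszul_component_koszul {K : AnchoredBracket A L} (hK : K.IsLie) (h : IsCompl T N)
    (hT : ∀ x ∈ T, ∀ y ∈ T, K.bracket x y ∈ T) {p k : ℕ}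
    {η : L [⋀^Fin k]→ₗ[A] A} (hη : η ∈ ofType T N p k) :
    component h p (K.koszul (component h p (K.koszul η))) = 0 := by
  have h1 : InFiltration T N p (K.koszul η) :=
    InFiltration.koszul K h hT fun l x hx hl => mem_ofType_iff.1 hη l x hx hl.ne
  have h2 : InFiltration T N (p + 1) (component h p (K.koszul η) - K.koszul η) := by
    intro l x hx hl
    rw [AlternatingMap.sub_apply, sub_eq_zero]
    rcases (Nat.lt_succ_iff.1 hl).lt_or_eq with hl | hl
    · rw [h1 l x hx hl, mem_ofType_iff.1 (component_mem h p _) l x hx hl.ne]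
    · exact component_apply_of_hasLabels h _ hx hl
  have h3 := component_eq_zero_of_inFiltration h (InFiltration.koszul K h hT h2)
  rwa [koszul_sub, hK.koszul_koszul, sub_zero] at h3

lemma leafDifferential_leafDifferential {K : AnchoredBracket A L} (hK : K.IsLie) (h : IsCompl T N)
    (hT : ∀ x ∈ T, ∀ y ∈ T, K.bracket x y ∈ T) (I : Subalgebra ℝ A)
    (hI : ∀ f ∈ I, ∀ x ∈ T, K.anchor x f = 0) (p k : ℕ) (η : ofType T N p k) :
    K.leafDifferential h I hI p (k + 1) (K.leafDifferential h I hI p k η) = 0 :=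
  Subtype.ext (component_koszul_component_koszul hK h hT η.2)

/-! ### Transport along an isomorphism -/

variable {L' : Type*} [AddCommGroup L'] [Module A L'] {T' N' : Submodule A L'}

lemma compLinearMap_mem_ofType {Φ : L' →ₗ[A] L} (hΦT : ∀ x ∈ T', Φ x ∈ T)
    (hΦN : ∀ x ∈ N', Φ x ∈ N) {p k : ℕ} {η : L [⋀^Fin k]→ₗ[A] A} (hη : η ∈ ofType T N p k) :
    η.compLinearMap Φ ∈ ofType T' N' p k := fun S hS x hN hT =>
  hη S hS (fun i => Φ (x i)) (fun i hi => hΦN _ (hN i hi)) (fun i hi => hΦT _ (hT i hi))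

/-- Precomposition with a linear isomorphism respecting the decompositions, on the cochains of a
given type. -/
noncomputable def ofTypeCongr (I : Subalgebra ℝ A) (Φ : L' ≃ₗ[A] L) (hΦT : ∀ x, x ∈ T' ↔ Φ x ∈ T)
    (hΦN : ∀ x, x ∈ N' ↔ Φ x ∈ N) (p k : ℕ) : ofType T N p k ≃ₗ[I] ofType T' N' p k where
  toFun η := ⟨η.1.compLinearMap Φ.toLinearMap,
    compLinearMap_mem_ofType (fun x hx => (hΦT x).1 hx) (fun x hx => (hΦN x).1 hx) η.2⟩
  invFun η := ⟨η.1.compLinearMap Φ.symm.toLinearMap,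
    compLinearMap_mem_ofType (fun x hx => (hΦT _).2 (by simpa using hx))
      (fun x hx => (hΦN _).2 (by simpa using hx)) η.2⟩
  map_add' _ _ := rfl
  map_smul' _ _ := rfl
  left_inv η := by ext x; simp
  right_inv η := by ext x; simp

/-- Φ need not be a morphism of brackets. With p normal arguments in total, each defect Φ[x, y] −
[Φx, Φy] enters η together with a number of normal arguments different from p, hence contributes
nothing. -/
lemma koszul_compLinearMap_of_hasLabels {K' : AnchoredBracket A L'} {Φ : L' →ₗ[A] L}
    (h : IsCompl T N)
    (hΦT : ∀ x ∈ T', Φ x ∈ T) (hΦN : ∀ x ∈ N', Φ x ∈ N)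
    (hanchor : ∀ x ∈ T', K'.anchor x = K.anchor (Φ x))
    (hTT : ∀ x ∈ T', ∀ y ∈ T', Φ (K'.bracket x y) - K.bracket (Φ x) (Φ y) ∈ N)
    (hTN : ∀ x ∈ T', ∀ y ∈ N', Φ (K'.bracket x y) - K.bracket (Φ x) (Φ y) ∈ T)
    {p k : ℕ} {η : L [⋀^Fin k]→ₗ[A] A} (hη : η ∈ ofType T N p k)
    {l : Fin (k + 1) → Bool} {x : Fin (k + 1) → L'} (hx : HasLabels T' N' l x)
    (hl : labelCount l = p) :
    K'.koszul (η.compLinearMap Φ) x = K.koszul η (fun i => Φ (x i)) := by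
  rw [mem_ofType_iff] at hη
  have hy : HasLabels T N l fun i => Φ (x i) := fun i => by
    have := hx i
    cases hi : l i <;> rw [hi] at this
    · exact hΦT _ this
    · exact hΦN _ this
  rw [koszul_apply, koszul_apply, koszulFun, koszulFun]
  congr 1
  · refine Finset.sum_congr rfl fun i _ => ?_
    have e : (η.compLinearMap Φ) (i.removeNth x) = η (i.removeNth fun i => Φ (x i)) := rfl
    rw [e]
    have hxi := hx i
    cases hi : l i
    · rw [hi] at hxi
      rw [hanchor _ hxi]
    -- Removing a normal argument leaves p − 1 of them, so anchors of normal arguments never act on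
    -- a nonzero value.
    · rw [hη _ _ (hy.removeNth i), map_zero, map_zero]
      have := labelCount_removeNth l i
      rw [hi, Bool.toNat_true] at this
      omega
  · cases k with
    | zero => rfl
    | succ n =>
      rw [bracketSum, bracketSum, neg_inj]
      refine Finset.sum_congr rfl fun i _ => Finset.sum_congr rfl fun j hj => ?_
      have hij : i ≤ j := Finset.mem_Ici.1 hj
      have hc := labelCount_removeNth_removeNth l hij
      have hr := (hy.removeNth i.castSucc).removeNth j
      set r := j.removeNth (i.castSucc.removeNth fun i => Φ (x i))
      have e : (η.compLinearMap Φ) (Matrix.vecCons (K'.bracket (x i.castSucc) (x j.succ))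
          (j.removeNth (i.castSucc.removeNth x))) =
          η (Fin.cons (Φ (K'.bracket (x i.castSucc) (x j.succ))) r) := by
        rw [AlternatingMap.compLinearMap_apply]
        congr 1
        ext m
        refine Fin.cases ?_ (fun m => ?_) m <;> rfl
      rw [e, Matrix.vecCons]
      set a := x i.castSucc
      set b := x j.succ
      have ha : a ∈ bif l i.castSucc then N' else T' := hx i.castSucc
      have hb : b ∈ bif l j.succ then N' else T' := hx j.succ
      have hδ : η (Fin.cons (Φ (K'.bracket a b) - K.bracket (Φ a) (Φ b)) r) = 0 := by
        cases hi : l i.castSucc <;> cases hj : l j.succ <;> rw [hi] at ha hc <;> rw [hj] at hb hc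
        · refine hη _ _ (hr.cons (b := true) (hTT a ha b hb)) ?_
          rw [labelCount_cons, Bool.toNat_true]
          simp only [Bool.toNat_false] at hc
          omega
        · refine hη _ _ (hr.cons (b := false) (hTN a ha b hb)) ?_
          rw [labelCount_cons, Bool.toNat_false]
          simp only [Bool.toNat_false, Bool.toNat_true] at hc
          omega
        · have h' : Φ (K'.bracket a b) - K.bracket (Φ a) (Φ b) ∈ T := by
            rw [K'.bracket_swap, K.bracket_swap, map_neg, ← neg_sub', neg_mem_iff]
            exact hTN b hb a ha
          refine hη _ _ (hr.cons (b := false) h') ?_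
          rw [labelCount_cons, Bool.toNat_false]
          simp only [Bool.toNat_false, Bool.toNat_true] at hc
          omega
        -- For two normal arguments nothing is assumed of the defect: the other arguments contain p
        -- − 2 normal ones, so either component of the defect gives at most p − 1.
        · obtain ⟨t, n, ht, hn, htn⟩ := Submodule.codisjoint_iff_exists_add_eq.1 h.codisjoint
            (Φ (K'.bracket a b) - K.bracket (Φ a) (Φ b))
          simp only [Bool.toNat_true] at hc
          rw [← htn, map_cons_add, hη _ _ (hr.cons (b := false) ht),
            hη _ _ (hr.cons (b := true) hn), add_zero]
          · rw [labelCount_cons, Bool.toNat_true]; omega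
          · rw [labelCount_cons, Bool.toNat_false]; omega
      have := map_cons_add η (Φ (K'.bracket a b) - K.bracket (Φ a) (Φ b)) (K.bracket (Φ a) (Φ b)) r
      rw [sub_add_cancel, hδ, zero_add] at this
      rw [this]

lemma map_mixed {Φ : L' →ₗ[A] L} (h : IsCompl T N) (h' : IsCompl T' N')
    (hΦT : ∀ x ∈ T', Φ x ∈ T) (hΦN : ∀ x ∈ N', Φ x ∈ N) {k : ℕ} (S : Finset (Fin k))
    (x : Fin k → L') : (fun i => Φ (mixed h' S x i)) = mixed h S fun i => Φ (x i) := by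
  have key : ∀ {T N : Submodule A L} {T' N' : Submodule A L'} (h : IsCompl T N)
      (h' : IsCompl T' N') (_ : ∀ x ∈ T', Φ x ∈ T) (_ : ∀ x ∈ N', Φ x ∈ N) (y : L'),
      Φ (T'.projection N' h' y) = T.projection N h (Φ y) := by
    intro T N T' N' h h' hT hN y
    conv_rhs => rw [← Submodule.projection_add_projection_eq_self h' y, map_add, map_add]
    have h1 : Φ (T'.projection N' h' y) ∈ T := hT _ (by simp)
    have h2 : Φ (N'.projection T' h'.symm y) ∈ N := hN _ (by simp)
    rw [Submodule.projection_apply h (Φ (T'.projection N' h' y)),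
      Submodule.projectionOnto_apply_of_mem_left h h1,
      Submodule.projection_apply h (Φ (N'.projection T' h'.symm y)),
      Submodule.projectionOnto_apply_of_mem_right h h2]
    simp
  ext i
  by_cases hi : i ∈ S
  · simp only [mixed, hi, if_true]
    exact key h.symm h'.symm hΦN hΦT _
  · simp only [mixed, hi, if_false]
    exact key h h' hΦT hΦN _

lemma ofTypeCongr_leafDifferential {K' : AnchoredBracket A L'} {Φ : L' ≃ₗ[A] L}
    (h : IsCompl T N) (h' : IsCompl T' N')
    (hΦT : ∀ x, x ∈ T' ↔ Φ x ∈ T) (hΦN : ∀ x, x ∈ N' ↔ Φ x ∈ N)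
    (hanchor : ∀ x ∈ T', K'.anchor x = K.anchor (Φ x))
    (hTT : ∀ x ∈ T', ∀ y ∈ T', Φ (K'.bracket x y) - K.bracket (Φ x) (Φ y) ∈ N)
    (hTN : ∀ x ∈ T', ∀ y ∈ N', Φ (K'.bracket x y) - K.bracket (Φ x) (Φ y) ∈ T)
    (I : Subalgebra ℝ A) (hI : ∀ f ∈ I, ∀ x ∈ T, K.anchor x f = 0)
    (hI' : ∀ f ∈ I, ∀ x ∈ T', K'.anchor x f = 0) (p k : ℕ) (η : ofType T N p k) :
    ofTypeCongr I Φ hΦT hΦN p (k + 1) (K.leafDifferential h I hI p k η) =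
      K'.leafDifferential h' I hI' p k (ofTypeCongr I Φ hΦT hΦN p k η) := by
  ext x
  change component h p (K.koszul η.1) (fun i => Φ (x i)) =
    component h' p (K'.koszul (η.1.compLinearMap Φ.toLinearMap)) x
  rw [component_apply, component_apply]
  refine Finset.sum_congr rfl fun S hS => ?_
  rw [koszul_compLinearMap_of_hasLabels K h (fun x hx => (hΦT x).1 hx) (fun x hx => (hΦN x).1 hx)
    hanchor hTT hTN η.2 (hasLabels_mixed h' S x)
    (by rw [labelCount_decide, (Finset.mem_powersetCard.1 hS).2])]
  congr 1
  exact (map_mixed h h' (fun x hx => (hΦT x).1 hx) (fun x hx => (hΦN x).1 hx) S x).symm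

end AnchoredBracket

/-- Isomorphic complexes have isomorphic cohomology. -/
lemma nonempty_cohomology_equiv {R : Type*} [CommRing R] {C D : ℕ → Type*}
    [∀ q, AddCommGroup (C q)] [∀ q, Module R (C q)] [∀ q, AddCommGroup (D q)]
    [∀ q, Module R (D q)] (d : ∀ q, C q →ₗ[R] C (q + 1)) (d' : ∀ q, D q →ₗ[R] D (q + 1))
    (e : ∀ q, C q ≃ₗ[R] D q) (he : ∀ q x, e (q + 1) (d q x) = d' q (e q x)) (q : ℕ) :
    Nonempty (Cohomology d q ≃ₗ[R] Cohomology d' q) := by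
  have hk : (LinearMap.ker (d q)).map (e q).toLinearMap = LinearMap.ker (d' q) := by
    ext y
    simp only [Submodule.mem_map, LinearMap.mem_ker]
    constructor
    · rintro ⟨x, hx, rfl⟩
      exact (he q x).symm.trans (by rw [hx, map_zero])
    · intro hy
      refine ⟨(e q).symm y, (e (q + 1)).injective ?_, by simp⟩
      rw [he, map_zero, LinearEquiv.apply_symm_apply, hy]
  have hb : ∀ x, x ∈ boundaries d q ↔ e q x ∈ boundaries d' q := by
    intro x
    cases q with
    | zero => simp [boundaries]
    | succ q =>
      simp only [boundaries, LinearMap.mem_range]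
      constructor
      · rintro ⟨y, rfl⟩
        exact ⟨e q y, (he q y).symm⟩
      · rintro ⟨y, hy⟩
        refine ⟨(e q).symm y, (e (q + 1)).injective ?_⟩
        rw [he, LinearEquiv.apply_symm_apply, hy]
  refine ⟨Submodule.Quotient.equiv _ _ (LinearEquiv.ofSubmodules (e q) _ _ hk) ?_⟩
  ext y
  constructor
  · rintro ⟨x, hx, rfl⟩
    exact (hb x).1 hx
  · intro hy
    refine ⟨(LinearEquiv.ofSubmodules (e q) _ _ hk).symm y, (hb _).2 ?_, by simp⟩
    have h2 : e q ((LinearEquiv.ofSubmodules (e q) _ _ hk).symm y : C q) = y :=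
      congrArg Subtype.val ((LinearEquiv.ofSubmodules (e q) _ _ hk).apply_symm_apply y)
    exact h2.symm ▸ hy

/-! ### The Lie bracket as a commutator -/

section LieBracket

variable {E : Type*} [NormedAddCommGroup E] [NormedSpace ℝ E]
  {M : Type*} [TopologicalSpace M] [ChartedSpace E M] [IsManifold 𝓘(ℝ, E) ∞ M]
  [FiniteDimensional ℝ E]

lemma mdifferentiableAt_extChartAt_symm (x₀ : M) {y : E}
    (hy : y ∈ (extChartAt 𝓘(ℝ, E) x₀).target) :
    MDifferentiableAt 𝓘(ℝ, E) 𝓘(ℝ, E) (extChartAt 𝓘(ℝ, E) x₀).symm y :=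
  ((contMDiffOn_extChartAt_symm (n := ∞) x₀).contMDiffAt
    ((isOpen_extChartAt_target x₀).mem_nhds hy)).mdifferentiableAt (by simp)

/-- A vector field read in a chart. -/
noncomputable def chartField (x₀ : M) (X : VectorFields E M) : E → E :=
  VectorField.mpullbackWithin 𝓘(ℝ, E) 𝓘(ℝ, E) (extChartAt 𝓘(ℝ, E) x₀).symm X
    (Set.range 𝓘(ℝ, E))

/-- The derivative of the inverse of a chart. -/
noncomputable def chartSymmDeriv (x₀ : M) (y : E) : E →L[ℝ] E :=
  mfderiv 𝓘(ℝ, E) 𝓘(ℝ, E) (extChartAt 𝓘(ℝ, E) x₀).symm y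

lemma mfderivWithin_range_extChartAt_symm (x₀ : M) (y : E) :
    mfderivWithin 𝓘(ℝ, E) 𝓘(ℝ, E) (extChartAt 𝓘(ℝ, E) x₀).symm (Set.range 𝓘(ℝ, E)) y =
      chartSymmDeriv x₀ y := by
  rw [ModelWithCorners.range_eq_univ, mfderivWithin_univ]; rfl

lemma chartField_apply (x₀ : M) (X : VectorFields E M) (y : E) :
    chartField x₀ X y = (chartSymmDeriv x₀ y).inverse (X ((extChartAt 𝓘(ℝ, E) x₀).symm y)) := by
  rw [← mfderivWithin_range_extChartAt_symm]
  rfl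

lemma isInvertible_chartSymmDeriv (x₀ : M) {y : E}
    (hy : y ∈ (extChartAt 𝓘(ℝ, E) x₀).target) : (chartSymmDeriv x₀ y).IsInvertible := by
  rw [← mfderivWithin_range_extChartAt_symm]
  exact isInvertible_mfderivWithin_extChartAt_symm (I := 𝓘(ℝ, E)) hy

lemma chartSymmDeriv_chartField (x₀ : M) (X : VectorFields E M) {y : E}
    (hy : y ∈ (extChartAt 𝓘(ℝ, E) x₀).target) :
    chartSymmDeriv x₀ y (chartField x₀ X y) = X ((extChartAt 𝓘(ℝ, E) x₀).symm y) := by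
  rw [chartField_apply]
  exact (isInvertible_chartSymmDeriv x₀ hy).self_apply_inverse _

lemma mvfderiv_chartSymmDeriv (x₀ : M) (f : SmoothFunctions E M) {y : E}
    (hy : y ∈ (extChartAt 𝓘(ℝ, E) x₀).target) (v : E) :
    mvfderiv 𝓘(ℝ, E) f ((extChartAt 𝓘(ℝ, E) x₀).symm y) (chartSymmDeriv x₀ y v) =
      fderiv ℝ (f ∘ (extChartAt 𝓘(ℝ, E) x₀).symm) y v := by
  have h := mfderiv_comp y (mdifferentiableAt_fun f ((extChartAt 𝓘(ℝ, E) x₀).symm y))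
    (mdifferentiableAt_extChartAt_symm x₀ hy)
  rw [mfderiv_eq_fderiv] at h
  rw [h]
  rfl

lemma lieDeriv_extChartAt_symm (x₀ : M) (X : VectorFields E M) (f : SmoothFunctions E M) {y : E}
    (hy : y ∈ (extChartAt 𝓘(ℝ, E) x₀).target) :
    lieDeriv X f ((extChartAt 𝓘(ℝ, E) x₀).symm y) =
      fderiv ℝ (f ∘ (extChartAt 𝓘(ℝ, E) x₀).symm) y (chartField x₀ X y) := by
  rw [← mvfderiv_chartSymmDeriv x₀ f hy, chartSymmDeriv_chartField x₀ X hy]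
  rfl

lemma differentiableAt_chartField (x₀ : M) (X : VectorFields E M) :
    DifferentiableAt ℝ (chartField x₀ X) (extChartAt 𝓘(ℝ, E) x₀ x₀) := by
  have : IsManifold 𝓘(ℝ, E) 2 M := IsManifold.of_le (n := ∞) ENat.LEInfty.out
  have : CompleteSpace E := FiniteDimensional.complete ℝ E
  have h := MDifferentiableWithinAt.differentiableWithinAt_mpullbackWithin_vectorField
    (I := 𝓘(ℝ, E)) (s := Set.univ) (X.mdifferentiableAt (x := x₀)).mdifferentiableWithinAt
  change DifferentiableWithinAt ℝ (chartField x₀ X) _ _ at h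
  rwa [Set.preimage_univ, ModelWithCorners.range_eq_univ, Set.univ_inter,
    differentiableWithinAt_univ] at h

lemma chartField_lieBracket (x₀ : M) (X Y : VectorFields E M) :
    chartField x₀ (lieBracket X Y) (extChartAt 𝓘(ℝ, E) x₀ x₀) =
      VectorField.lieBracket ℝ (chartField x₀ X) (chartField x₀ Y)
        (extChartAt 𝓘(ℝ, E) x₀ x₀) := by
  have hy := mem_extChartAt_target (I := 𝓘(ℝ, E)) x₀
  have hinv := isInvertible_chartSymmDeriv x₀ hy
  set D := chartSymmDeriv x₀ (extChartAt 𝓘(ℝ, E) x₀ x₀)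
  -- D' is the derivative of the chart and D that of its inverse. They are mutually inverse, which
  -- is needed because `mlieBracket` is pulled back by `D'.inverse` while `chartField` uses
  -- `D.inverse`.
  set D' : E →L[ℝ] E := mfderiv 𝓘(ℝ, E) 𝓘(ℝ, E) (extChartAt 𝓘(ℝ, E) x₀) x₀ with hD'
  have hDD' : D ∘L D' = ContinuousLinearMap.id ℝ E := by
    have h := mfderivWithin_extChartAt_symm_comp_mfderiv_extChartAt'
      (I := 𝓘(ℝ, E)) (mem_extChartAt_source (I := 𝓘(ℝ, E)) x₀)
    rwa [mfderivWithin_range_extChartAt_symm] at h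
  have hD'D : D' ∘L D = ContinuousLinearMap.id ℝ E := by
    have h1 : D' = D.inverse := by
      rw [← ContinuousLinearMap.id_comp D', ← hinv.inverse_comp_self,
        ContinuousLinearMap.comp_assoc, hDD', ContinuousLinearMap.comp_id]
    rw [h1, hinv.inverse_comp_self]
  have hval : lieBracket X Y x₀ = D'.inverse (VectorField.lieBracketWithin ℝ (chartField x₀ X)
      (chartField x₀ Y) ((extChartAt 𝓘(ℝ, E) x₀).symm ⁻¹' Set.univ ∩ Set.range 𝓘(ℝ, E))
      (extChartAt 𝓘(ℝ, E) x₀ x₀)) := rfl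
  have hx : (lieBracket X Y ((extChartAt 𝓘(ℝ, E) x₀).symm (extChartAt 𝓘(ℝ, E) x₀ x₀)) : E) =
      lieBracket X Y x₀ :=
    congrArg (fun x => (lieBracket X Y x : E)) (extChartAt_to_inv (I := 𝓘(ℝ, E)) x₀)
  rw [chartField_apply, hx, hval, ContinuousLinearMap.inverse_eq hD'D hDD', Set.preimage_univ,
    ModelWithCorners.range_eq_univ, Set.univ_inter, VectorField.lieBracketWithin_univ]
  exact hinv.inverse_apply_self _

/-- In a chart, X(Yf) = D²f(X, Y) + Df(DY·X). The symmetric second derivative cancels in the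
commutator, and Df applied to DY·X − DX·Y remains. -/
lemma lieDeriv_lieBracket (X Y : VectorFields E M) (f : SmoothFunctions E M) :
    lieDeriv (lieBracket X Y) f = lieDeriv X (lieDeriv Y f) - lieDeriv Y (lieDeriv X f) := by
  ext x₀
  set φ := extChartAt 𝓘(ℝ, E) x₀ with hφ
  have hy := mem_extChartAt_target (I := 𝓘(ℝ, E)) x₀
  have hx : φ.symm (φ x₀) = x₀ := extChartAt_to_inv x₀
  have hval : ∀ (X : VectorFields E M) (g : SmoothFunctions E M), lieDeriv X g x₀ =
      fderiv ℝ (g ∘ φ.symm) (φ x₀) (chartField x₀ X (φ x₀)) := fun X g => by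
    have := lieDeriv_extChartAt_symm x₀ X g hy
    rwa [← hφ, hx] at this
  have hf : ContDiffAt ℝ ∞ (f ∘ φ.symm) (φ x₀) := by
    have h1 : ContMDiffAt 𝓘(ℝ, E) 𝓘(ℝ, E) ∞ φ.symm (φ x₀) :=
      (contMDiffOn_extChartAt_symm (n := ∞) x₀).contMDiffAt
        ((isOpen_extChartAt_target x₀).mem_nhds hy)
    exact ((f.contMDiff (φ.symm (φ x₀))).comp _ h1).contDiffAt
  have hf2 : DifferentiableAt ℝ (fderiv ℝ (f ∘ φ.symm)) (φ x₀) :=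
    (hf.fderiv_right (m := 1) (by rw [one_add_one_eq_two]; exact ENat.LEInfty.out)).differentiableAt (by simp)
  -- The inner derivative gets differentiated again, so its chart expression is needed near the
  -- point and not only at it.
  have hloc : ∀ (Y : VectorFields E M), lieDeriv Y f ∘ φ.symm =ᶠ[nhds (φ x₀)]
      fun y => fderiv ℝ (f ∘ φ.symm) y (chartField x₀ Y y) := fun Y => by
    filter_upwards [(isOpen_extChartAt_target x₀).mem_nhds hy] with y hy
    exact lieDeriv_extChartAt_symm x₀ Y f hy
  have h2 : ∀ X Y : VectorFields E M, lieDeriv X (lieDeriv Y f) x₀ =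
      fderiv ℝ (fderiv ℝ (f ∘ φ.symm)) (φ x₀) (chartField x₀ X (φ x₀)) (chartField x₀ Y (φ x₀)) +
      fderiv ℝ (f ∘ φ.symm) (φ x₀)
        (fderiv ℝ (chartField x₀ Y) (φ x₀) (chartField x₀ X (φ x₀))) := fun X Y => by
    rw [hval, (hloc Y).fderiv_eq, fderiv_clm_apply hf2 (differentiableAt_chartField x₀ Y)]
    simp [add_comm]
  have hsymm : IsSymmSndFDerivAt ℝ (f ∘ φ.symm) (φ x₀) :=
    hf.isSymmSndFDerivAt (by
      rw [minSmoothness_of_isRCLikeNormedField]; exact ENat.LEInfty.out)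
  rw [hval, chartField_lieBracket]
  have e : (lieDeriv X (lieDeriv Y f) - lieDeriv Y (lieDeriv X f)) x₀ =
    lieDeriv X (lieDeriv Y f) x₀ - lieDeriv Y (lieDeriv X f) x₀ := rfl
  rw [e, h2, h2, hsymm.eq, VectorField.lieBracket, map_sub]
  ring

lemma tangentBracket_isLie : (tangentBracket E M).IsLie where
  anchor_bracket X Y f := lieDeriv_lieBracket X Y f
  jacobi X Y Z := by
    have : CompleteSpace E := FiniteDimensional.complete ℝ E
    have : IsManifold 𝓘(ℝ, E) (minSmoothness ℝ 3) M := by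
      rw [minSmoothness_of_isRCLikeNormedField]
      exact IsManifold.of_le (n := ∞) ENat.LEInfty.out
    have hs : ∀ X : VectorFields E M, ContMDiff 𝓘(ℝ, E) 𝓘(ℝ, E).tangent (minSmoothness ℝ 2)
        (fun x => (⟨x, X x⟩ : TangentBundle 𝓘(ℝ, E) M)) := fun X => by
      rw [minSmoothness_of_isRCLikeNormedField]
      exact X.contMDiff.of_le (by exact ENat.LEInfty.out)
    have h := VectorField.leibniz_identity_mlieBracket (hs X) (hs Y) (hs Z)
    ext x
    exact (sub_eq_of_eq_add (congrFun h x)).symm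

end LieBracket
/-! ### Local frames, tensoriality and gluing -/

section Local

variable {E : Type*} [NormedAddCommGroup E] [NormedSpace ℝ E]
  {M : Type*} [TopologicalSpace M] [ChartedSpace E M] [IsManifold 𝓘(ℝ, E) ∞ M]
  [FiniteDimensional ℝ E]

/-- Evaluation of smooth functions at a point. -/
noncomputable def evalFun (x : M) : SmoothFunctions E M →+* ℝ := ContMDiffMap.evalRingHom x

lemma evalFun_apply (x : M) (f : SmoothFunctions E M) : evalFun x f = f x := rfl

/-- Evaluation of vector fields at a point. -/
noncomputable def evalField (x : M) : VectorFields E M →+ TangentSpace 𝓘(ℝ, E) x :=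
  (Pi.evalAddMonoidHom _ x).comp
    (ContMDiffSection.coeAddHom 𝓘(ℝ, E) E ∞ (TangentSpace 𝓘(ℝ, E) : M → Type _))

lemma evalField_apply (x : M) (X : VectorFields E M) : evalField x X = X x := rfl

/-- Around every point there are vector fields `F_i` and `1`-forms `θ_i` with
`ψ Y = ∑ θ_i(Y) F_i` for a function `ψ` not vanishing at the point. -/
lemma exists_local_frame [T2Space M] (x₀ : M) : ∃ (n : ℕ) (F : Fin n → VectorFields E M)
    (θ : Fin n → OneForms E M) (ψ : SmoothFunctions E M), ψ x₀ ≠ 0 ∧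
    (∀ Y, ∑ i, θ i Y • F i = ψ • Y) ∧
    ∃ c : Fin n → E →L[ℝ] ℝ, ∀ i Y, θ i Y x₀ = c i (Y x₀) := by
  obtain ⟨χ⟩ : Nonempty (SmoothBumpFunction 𝓘(ℝ, E) x₀) := inferInstance
  set e := trivializationAt E (TangentSpace 𝓘(ℝ, E)) x₀
  set b := Module.finBasis ℝ E
  have : ContMDiffVectorBundle 1 E (TangentSpace 𝓘(ℝ, E) : M → Type _) 𝓘(ℝ, E) := inferInstance
  have hsub : tsupport χ ⊆ e.baseSet := χ.tsupport_subset_chartAt_source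
  have hχ : ContMDiff 𝓘(ℝ, E) 𝓘(ℝ, ℝ) ∞ χ := χ.contMDiff
  let F : Fin (Module.finrank ℝ E) → VectorFields E M := fun i =>
    ⟨fun x => χ x • e.localFrame b i x,
      ContMDiffOn.smul_section_of_tsupport hχ.contMDiffOn e.open_baseSet hsub
        (e.contMDiffOn_localFrame_baseSet ∞ b i)⟩
  have hθ : ∀ i (Y : VectorFields E M), ContMDiff 𝓘(ℝ, E) 𝓘(ℝ, ℝ) ∞
      fun x => χ x • e.localFrameCoeff 𝓘(ℝ, E) b i x (Y x) := fun i Y => by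
    refine χ.contMDiff_smul ?_
    intro x hx
    exact (contMDiffAt_localFrameCoeff (e := e) (s := fun x => Y x) b hx
      Y.contMDiff.contMDiffAt i).contMDiffWithinAt
  let θ : Fin (Module.finrank ℝ E) → OneForms E M := fun i =>
    { toFun := fun Y => ⟨_, hθ i Y⟩
      map_add' := fun Y Z => ContMDiffMap.ext fun x =>
        (congrArg (χ x * ·) (map_add (e.localFrameCoeff 𝓘(ℝ, E) b i x) (Y x) (Z x))).trans
          (mul_add _ _ _)
      map_smul' := fun f Y => ContMDiffMap.ext fun x =>
        (congrArg (χ x * ·) (map_smul (e.localFrameCoeff 𝓘(ℝ, E) b i x) (f x) (Y x))).trans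
          (mul_left_comm _ _ _) }
  have hθa : ∀ i Y x, θ i Y x = χ x * e.localFrameCoeff 𝓘(ℝ, E) b i x (Y x) := fun _ _ _ => rfl
  -- One factor χ extends the local frame to M, the other extends the coframe; hence the square.
  let ψ : SmoothFunctions E M := ⟨fun x => χ x * χ x, hχ.mul hχ⟩
  refine ⟨_, F, θ, ψ, ?_, fun Y => ?_, fun i =>
    χ x₀ • LinearMap.toContinuousLinearMap
      (show E →ₗ[ℝ] ℝ from e.localFrameCoeff 𝓘(ℝ, E) b i x₀),
    fun i Y => rfl⟩
  · change χ x₀ * χ x₀ ≠ 0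
    simp
  · ext x
    have h1 : (∑ i, θ i Y • F i) x = ∑ i, (θ i Y x) • (χ x • e.localFrame b i x) := by
      rw [← evalField_apply, map_sum]; rfl
    have h2 : (ψ • Y) x = (χ x * χ x) • Y x := rfl
    rw [h1, h2]
    by_cases hx : x ∈ e.baseSet
    · conv_rhs => rw [e.eq_sum_localFrameCoeff_smul (I := 𝓘(ℝ, E)) (b := b) (s := fun x => Y x) hx]
      rw [Finset.smul_sum]
      refine Finset.sum_congr rfl fun i _ => ?_
      rw [hθa, smul_smul, smul_smul]
      congr 1
      ring
    · have h0 : χ x = 0 := image_eq_zero_of_notMem_tsupport fun h => hx (hsub h)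
      simp [h0]

/-- The value of a `1`-form on a vector field at a point depends on the vector only. -/
lemma form_apply_eq_zero [T2Space M] (α : OneForms E M) {Y : VectorFields E M} {x : M}
    (hY : Y x = 0) : α Y x = 0 := by
  obtain ⟨n, F, θ, ψ, hψ, h, c, hc⟩ := exists_local_frame (E := E) x
  have h0 : ∀ i, θ i Y x = 0 := fun i => by rw [hc, hY]; exact map_zero (c i)
  have h1 := congrArg (fun Z => evalFun x (α Z)) (h Y)
  simp only [map_sum, map_smul, smul_eq_mul, map_mul, evalFun_apply, h0, zero_mul,
    Finset.sum_const_zero] at h1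
  exact (mul_eq_zero.1 h1.symm).resolve_left hψ

lemma form_apply_congr [T2Space M] (α : OneForms E M) {Y Z : VectorFields E M} {x : M}
    (hY : Y x = Z x) : α Y x = α Z x := by
  have h : (Y - Z) x = 0 := by
    rw [ContMDiffSection.coe_sub, Pi.sub_apply, hY, sub_self]
  have h2 := form_apply_eq_zero α h
  rw [map_sub] at h2
  exact sub_eq_zero.1 h2

/-- The value of a `C^∞(M)`-linear function of `1`-forms at a point depends on the covector only. -/
lemma bidual_apply_eq_zero [T2Space M]
    (ξ : Module.Dual (SmoothFunctions E M) (OneForms E M)) {γ : OneForms E M} {x : M}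
    (hγ : ∀ Y, γ Y x = 0) : ξ γ x = 0 := by
  obtain ⟨n, F, θ, ψ, hψ, h, -⟩ := exists_local_frame (E := E) x
  -- The dual form of the frame identity: γ is expressed through the θ_i with coefficients γ(F_i),
  -- which vanish at x.
  have h1 : ∑ i, γ (F i) • θ i = ψ • γ := by
    refine LinearMap.ext fun Y => ?_
    have := congrArg γ (h Y)
    simp only [map_sum, map_smul, smul_eq_mul] at this
    simp only [LinearMap.sum_apply, LinearMap.smul_apply, smul_eq_mul, ← this, mul_comm]
  have h2 := congrArg (fun Z => evalFun x (ξ Z)) h1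
  simp only [map_sum, map_smul, smul_eq_mul, map_mul, evalFun_apply, hγ, zero_mul,
    Finset.sum_const_zero] at h2
  exact (mul_eq_zero.1 h2.symm).resolve_left hψ

/-- Every covector at a point is the differential of a smooth function. -/
lemma exists_lieDeriv_eq [T2Space M] (x₀ : M) (c : E →L[ℝ] ℝ) :
    ∃ g : SmoothFunctions E M, ∀ X : VectorFields E M, lieDeriv X g x₀ = c (X x₀) := by
  obtain ⟨χ⟩ : Nonempty (SmoothBumpFunction 𝓘(ℝ, E) x₀) := inferInstance
  set φ := extChartAt 𝓘(ℝ, E) x₀ with hφ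
  have hy := mem_extChartAt_target (I := 𝓘(ℝ, E)) x₀
  have hx : φ.symm (φ x₀) = x₀ := extChartAt_to_inv x₀
  -- The covector c read in the chart. The function is the linear form l of the coordinates, cut off
  -- by a bump function equal to 1 near the point.
  set l : E →L[ℝ] ℝ := c ∘L chartSymmDeriv x₀ (φ x₀)
  have hg : ContMDiff 𝓘(ℝ, E) 𝓘(ℝ, ℝ) ∞ fun x => χ x • l (φ x) := by
    refine χ.contMDiff_smul ?_
    exact l.contMDiff.comp_contMDiffOn (contMDiffOn_extChartAt (I := 𝓘(ℝ, E)) (n := ∞))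
  let g : SmoothFunctions E M := ⟨_, hg⟩
  refine ⟨g, fun X => ?_⟩
  have h1 := lieDeriv_extChartAt_symm x₀ X g hy
  rw [← hφ, hx] at h1
  have hcont : ContinuousAt φ.symm (φ x₀) := continuousAt_extChartAt_symm x₀
  have hev : (g ∘ φ.symm) =ᶠ[nhds (φ x₀)] l := by
    have h2 : ∀ᶠ y in nhds (φ x₀), χ (φ.symm y) = 1 := by
      have h3 : ∀ᶠ x in nhds (φ.symm (φ x₀)), χ x = 1 := by
        rw [hx]; exact χ.eventuallyEq_one
      exact hcont.eventually h3
    filter_upwards [h2, (isOpen_extChartAt_target x₀).mem_nhds hy] with y h2 h3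
    change χ (φ.symm y) • l (φ (φ.symm y)) = l y
    rw [h2, one_smul, φ.right_inv h3]
  rw [h1, hev.fderiv_eq, ContinuousLinearMap.fderiv]
  change c (chartSymmDeriv x₀ (φ x₀) (chartField x₀ X (φ x₀))) = _
  rw [chartSymmDeriv_chartField x₀ X hy, ← hφ]
  exact congrArg (fun x => c (X x)) hx

/-- At a given point every `1`-form agrees with an exact one. -/
lemma exists_differential_eq [T2Space M] (x₀ : M) (α : OneForms E M) :
    ∃ g : SmoothFunctions E M, ∀ X : VectorFields E M, differential g X x₀ = α X x₀ := by
  obtain ⟨n, F, θ, ψ, hψ, h, c, hc⟩ := exists_local_frame (E := E) x₀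
  -- The chosen covector is the value of α at x₀, obtained by applying α to the frame identity and
  -- dividing by ψ(x₀).
  obtain ⟨g, hg⟩ := exists_lieDeriv_eq (E := E) x₀ ((ψ x₀)⁻¹ • ∑ i, α (F i) x₀ • c i)
  refine ⟨g, fun X => (hg X).trans ?_⟩
  have h1 := congrArg (fun Z => evalFun x₀ (α Z)) (h X)
  simp only [map_sum, map_smul, smul_eq_mul, map_mul, evalFun_apply, hc] at h1
  have h2 : ∀ v : E, ((ψ x₀)⁻¹ • ∑ i, α (F i) x₀ • c i) v =
      (ψ x₀)⁻¹ * ∑ i, c i v * α (F i) x₀ := fun v => by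
    simp [mul_comm]
  exact (h2 (X x₀)).trans (by rw [h1, inv_mul_cancel_left₀ hψ])

lemma eq_zero_of_forms [T2Space M] {X : VectorFields E M} {x : M}
    (h : ∀ α : OneForms E M, α X x = 0) : X x = 0 := by
  by_contra hne
  have hne' : (show E from X x) ≠ 0 := hne
  obtain ⟨c, hc⟩ := SeparatingDual.exists_ne_zero (R := ℝ) hne'
  obtain ⟨g, hg⟩ := exists_lieDeriv_eq (E := E) x c
  exact hc ((hg X).symm.trans (h (differential g)))

lemma field_ext_forms [T2Space M] {X Y : VectorFields E M}
    (h : ∀ α : OneForms E M, α X = α Y) : X = Y := by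
  rw [← sub_eq_zero]
  ext x
  refine eq_zero_of_forms fun α => ?_
  rw [map_sub, h, sub_self]
  rfl

lemma field_ext_lieDeriv [T2Space M] {X Y : VectorFields E M}
    (h : ∀ f : SmoothFunctions E M, lieDeriv X f = lieDeriv Y f) : X = Y := by
  refine field_ext_forms fun α => ?_
  ext x
  obtain ⟨g, hg⟩ := exists_differential_eq x α
  rw [← hg, ← hg]
  exact congrArg (fun f : SmoothFunctions E M => f x) (h g)

/-! #### Gluing -/

/-- A family of functions `G_x` with `G_x(x) ≠ 0`. -/
def Separates (G : M → SmoothFunctions E M) : Prop := ∀ x, G x x ≠ 0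

lemma Separates.eq {G : M → SmoothFunctions E M} (hG : Separates G) {f g : SmoothFunctions E M}
    (h : ∀ x, G x * f = G x * g) : f = g := by
  ext x
  exact mul_left_cancel₀ (hG x) (congrArg (evalFun x) (h x))

lemma Separates.field_eq {G : M → SmoothFunctions E M} (hG : Separates G) {X Y : VectorFields E M}
    (h : ∀ x, G x • X = G x • Y) : X = Y := by
  ext x
  exact smul_right_injective _ (hG x) (congrArg (evalField x) (h x))

/-- Gluing by division: the value at y is h_y(y) / G_y(y), and compatibility identifies it near x
with h_x / G_x, a quotient of smooth functions. Local solutions known only up to a factor G_x thus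
glue without a partition of unity. -/
lemma Separates.exists_fun {G : M → SmoothFunctions E M} (hG : Separates G)
    {h : M → SmoothFunctions E M} (hh : ∀ x y, G y * h x = G x * h y) :
    ∃ f : SmoothFunctions E M, ∀ x, G x * f = h x := by
  have hv : ∀ x y, h y y / G y y * G x y = h x y := fun x y => by
    have h1 : G y y * h x y = G x y * h y y := congrArg (evalFun y) (hh x y)
    field_simp [hG y]
    rw [mul_comm, ← h1, mul_comm]
  have hs : ContMDiff 𝓘(ℝ, E) 𝓘(ℝ, ℝ) ∞ fun y => h y y / G y y := fun x => by
    have h1 : ContMDiffAt 𝓘(ℝ, E) 𝓘(ℝ, ℝ) ∞ (fun y => h x y / G x y) x :=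
      (h x).contMDiff.contMDiffAt.div₀ (G x).contMDiff.contMDiffAt (hG x)
    refine h1.congr_of_eventuallyEq ?_
    filter_upwards [(G x).contMDiff.continuous.continuousAt.eventually_ne (hG x)] with y hy
    rw [← hv x y, mul_div_cancel_right₀ _ hy]
  exact ⟨⟨_, hs⟩, fun x => by
    ext y
    exact (mul_comm _ _).trans (hv x y)⟩

/-- The values on each w are glued separately; linearity can be tested after multiplication by the
G_x. -/
lemma Separates.exists_dual {W : Type*} [AddCommGroup W] [Module (SmoothFunctions E M) W]
    {G : M → SmoothFunctions E M} (hG : Separates G)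
    {α : M → Module.Dual (SmoothFunctions E M) W} (hα : ∀ x y, G y • α x = G x • α y) :
    ∃ a : Module.Dual (SmoothFunctions E M) W, ∀ x, G x • a = α x := by
  have h1 : ∀ w, ∃ f : SmoothFunctions E M, ∀ x, G x * f = α x w := fun w =>
    hG.exists_fun fun x y => LinearMap.congr_fun (hα x y) w
  choose a ha using h1
  refine ⟨{ toFun := a, map_add' := fun v w => ?_, map_smul' := fun f w => ?_ },
    fun x => LinearMap.ext fun w => ha w x⟩
  · exact hG.eq fun x => by rw [mul_add, ha, ha, ha, map_add]
  · refine hG.eq fun x => ?_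
    rw [ha, map_smul, RingHom.id_apply, smul_eq_mul, smul_eq_mul, mul_left_comm, ha]

lemma Separates.exists_field {G : M → SmoothFunctions E M} (hG : Separates G)
    {X : M → VectorFields E M} (hX : ∀ x y, G y • X x = G x • X y) :
    ∃ Y : VectorFields E M, ∀ x, G x • Y = X x := by
  have hv : ∀ x y, G x y • ((G y y)⁻¹ • X y y) = X x y := fun x y => by
    have h1 : G y y • X x y = G x y • X y y := congrArg (evalField y) (hX x y)
    rw [smul_comm, ← h1, smul_smul, inv_mul_cancel₀ (hG y), one_smul]
  have hs : ContMDiff 𝓘(ℝ, E) 𝓘(ℝ, E).tangent ∞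
      fun y => (⟨y, (G y y)⁻¹ • X y y⟩ : TangentBundle 𝓘(ℝ, E) M) := fun x => by
    have h0 : ContMDiffAt 𝓘(ℝ, E) 𝓘(ℝ, ℝ) ∞ (fun y => (G x y)⁻¹) x :=
      (G x).contMDiff.contMDiffAt.inv₀ (hG x)
    have h1 := h0.smul_section (X x).contMDiff.contMDiffAt
    refine h1.congr_of_eventuallyEq ?_
    filter_upwards [(G x).contMDiff.continuous.continuousAt.eventually_ne (hG x)] with y hy
    have h2 : (G y y)⁻¹ • X y y = (G x y)⁻¹ • X x y := by
      rw [← hv x y, smul_smul, inv_mul_cancel₀ hy, one_smul]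
    rw [h2]
    rfl
  exact ⟨⟨_, hs⟩, fun x => by
    ext y
    exact hv x y⟩

/-- Every `C^∞(M)`-linear function of `1`-forms is the evaluation at a vector field. -/
lemma exists_field_of_bidual [T2Space M]
    (ξ : Module.Dual (SmoothFunctions E M) (OneForms E M)) :
    ∃ X : VectorFields E M, ∀ α, ξ α = α X := by
  have hloc : ∀ x : M, ∃ (ψ : SmoothFunctions E M) (X : VectorFields E M), ψ x ≠ 0 ∧
      ∀ α, ψ * ξ α = α X := fun x => by
    obtain ⟨n, F, θ, ψ, hψ, h, -⟩ := exists_local_frame (E := E) x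
    -- ξ applied to ψα = ∑ α(F_i) θ_i is the value of α on ∑ ξ(θ_i) F_i.
    refine ⟨ψ, ∑ i, ξ (θ i) • F i, hψ, fun α => ?_⟩
    have h1 : ∑ i, α (F i) • θ i = ψ • α := by
      refine LinearMap.ext fun Y => ?_
      have := congrArg α (h Y)
      simp only [map_sum, map_smul, smul_eq_mul] at this
      simp only [LinearMap.sum_apply, LinearMap.smul_apply, smul_eq_mul, ← this, mul_comm]
    have h2 := congrArg ξ h1
    simp only [map_sum, map_smul, smul_eq_mul] at h2 ⊢
    rw [← h2]
    exact Finset.sum_congr rfl fun i _ => mul_comm _ _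
  choose ψ X hψ hX using hloc
  have hG : Separates ψ := hψ
  obtain ⟨Y, hY⟩ := hG.exists_field (X := X) fun x y => field_ext_forms fun α => by
    rw [map_smul, map_smul, ← hX, ← hX, smul_eq_mul, smul_eq_mul, mul_left_comm]
  refine ⟨Y, fun α => hG.eq fun x => ?_⟩
  rw [hX, ← hY x, map_smul, smul_eq_mul]

end Local
section Poisson

variable {E : Type*} [NormedAddCommGroup E] [NormedSpace ℝ E]
  {M : Type*} [TopologicalSpace M] [ChartedSpace E M] [IsManifold 𝓘(ℝ, E) ∞ M]
  [FiniteDimensional ℝ E]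

namespace PoissonStructure

variable (P : PoissonStructure E M)

/-! ### The map `#` and the brackets -/

/-- The Poisson bracket of functions. -/
noncomputable def poissonBracket (f g : SmoothFunctions E M) : SmoothFunctions E M :=
  lieDeriv (P.sharp (differential f)) g

lemma poissonBracket_swap (f g : SmoothFunctions E M) :
    P.poissonBracket f g = - P.poissonBracket g f :=
  P.skew (differential f) (differential g)

/-- On Y, each of the three terms of the bracket, with its sign, is ±Y{f, g} because the Lie bracket
is the commutator: two come with a plus and one with a minus. -/
lemma formBracket_differential (f g : SmoothFunctions E M) :
    P.formBracket (differential f) (differential g) = differential (P.poissonBracket f g) := by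
  refine LinearMap.ext fun Y => ?_
  have h1 : lieDeriv (lieBracket (P.sharp (differential f)) Y) g =
      lieDeriv (P.sharp (differential f)) (lieDeriv Y g) - lieDeriv Y (P.poissonBracket f g) :=
    lieDeriv_lieBracket _ _ _
  have h2 : lieDeriv (lieBracket (P.sharp (differential g)) Y) f =
      lieDeriv (P.sharp (differential g)) (lieDeriv Y f) - lieDeriv Y (P.poissonBracket g f) :=
    lieDeriv_lieBracket _ _ _
  have h3 : lieDeriv Y (P.poissonBracket g f) = - lieDeriv Y (P.poissonBracket f g) := by
    rw [P.poissonBracket_swap g f]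
    exact (lieDerivation Y).map_neg _
  have h4 : P.formBracket (differential f) (differential g) Y =
      (lieDeriv (P.sharp (differential f)) (lieDeriv Y g) -
        lieDeriv (lieBracket (P.sharp (differential f)) Y) g) -
      (lieDeriv (P.sharp (differential g)) (lieDeriv Y f) -
        lieDeriv (lieBracket (P.sharp (differential g)) Y) f) -
      lieDeriv Y (P.poissonBracket f g) := rfl
  have h5 : differential (P.poissonBracket f g) Y = lieDeriv Y (P.poissonBracket f g) := rfl
  rw [h4, h5, h1, h2, h3]
  ring

variable [T2Space M]

/-- Tested on a function h, this is the Jacobi identity for f, g, h. -/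
lemma sharp_formBracket_differential (f g : SmoothFunctions E M) :
    P.sharp (P.formBracket (differential f) (differential g)) =
      lieBracket (P.sharp (differential f)) (P.sharp (differential g)) := by
  refine field_ext_lieDeriv fun h => ?_
  rw [formBracket_differential, lieDeriv_lieBracket]
  have hj : P.poissonBracket (P.poissonBracket f g) h +
      P.poissonBracket (P.poissonBracket g h) f +
      P.poissonBracket (P.poissonBracket h f) g = 0 := P.jacobi f g h
  have h1 : P.poissonBracket (P.poissonBracket h f) g =
      P.poissonBracket g (P.poissonBracket f h) := by
    rw [P.poissonBracket_swap _ g, P.poissonBracket_swap h f, neg_eq_iff_eq_neg]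
    exact (lieDerivation (P.sharp (differential g))).map_neg _
  rw [h1, P.poissonBracket_swap _ f] at hj
  change P.poissonBracket (P.poissonBracket f g) h =
    P.poissonBracket f (P.poissonBracket g h) - P.poissonBracket g (P.poissonBracket f h)
  linear_combination hj

/-- The defect D is `C^∞(M)`-linear in the second argument, since the anchor terms of the two
Leibniz rules agree, and it is skew. Its value at a point therefore depends only on the two
covectors there, which may be taken exact. -/
lemma sharp_formBracket (α β : OneForms E M) :
    P.sharp (P.formBracket α β) = lieBracket (P.sharp α) (P.sharp β) := by
  let K := tangentBracket E M
  let K' := P.cotangentBracket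
  let D : OneForms E M → OneForms E M →ₗ[SmoothFunctions E M] VectorFields E M := fun α =>
    { toFun := fun β => P.sharp (K'.bracket α β) - K.bracket (P.sharp α) (P.sharp β)
      map_add' := fun β γ => by simp only [map_add]; abel
      map_smul' := fun f β => by
        have h : K'.anchor α f = K.anchor (P.sharp α) f := rfl
        rw [K'.leibniz, map_add, map_smul, map_smul, map_smul, K.leibniz, h, RingHom.id_apply,
          smul_sub]
        abel }
  have hswap : ∀ α β, D α β = - D β α := fun α β => by
    change P.sharp (K'.bracket α β) - K.bracket (P.sharp α) (P.sharp β) =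
      -(P.sharp (K'.bracket β α) - K.bracket (P.sharp β) (P.sharp α))
    rw [K'.bracket_swap, K.bracket_swap, map_neg]
    abel
  have hpt : ∀ (γ α : OneForms E M) {β β' : OneForms E M} {x : M}, (∀ Y, β Y x = β' Y x) →
      γ (D α β) x = γ (D α β') x := fun γ α β β' x h => by
    have h1 := bidual_apply_eq_zero (γ ∘ₗ D α) (γ := β - β') (x := x) fun Y => by
      change β Y x - β' Y x = 0
      rw [h, sub_self]
    rw [map_sub] at h1
    exact sub_eq_zero.1 h1
  suffices h : D α β = 0 from sub_eq_zero.1 h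
  ext x
  refine eq_zero_of_forms fun γ => ?_
  obtain ⟨f, hf⟩ := exists_differential_eq x α
  obtain ⟨g, hg⟩ := exists_differential_eq x β
  have h0 : D (differential g) (differential f) = 0 :=
    sub_eq_zero.2 (P.sharp_formBracket_differential g f)
  rw [← hpt γ α hg, hswap, map_neg]
  have h1 := hpt γ (differential g) hf
  rw [h0, map_zero] at h1
  have h2 : (-(γ (D (differential g) α))) x = - (γ (D (differential g) α) x) := rfl
  rw [h2, ← h1]
  exact neg_zero

/-! ### The image of `#` -/

lemma sharp_mem_tangentFields (α : OneForms E M) : P.sharp α ∈ P.tangentFields :=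
  fun _ => ⟨α, rfl⟩

/-- By skewness, the kernel of # is the annihilator of its image; this lemma and the next are the
two inclusions. -/
lemma form_sharp_eq_zero {α : OneForms E M} (hα : α ∈ P.tangentFields.dualAnnihilator) :
    P.sharp α = 0 :=
  field_ext_forms fun β => by
    rw [P.skew, (Submodule.mem_dualAnnihilator α).1 hα _ (P.sharp_mem_tangentFields β), map_zero,
      neg_zero]

lemma form_eq_zero_on_tangentFields {α : OneForms E M} (hα : P.sharp α = 0) :
    α ∈ P.tangentFields.dualAnnihilator := by
  refine (Submodule.mem_dualAnnihilator α).2 fun Y hY => ?_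
  ext x
  obtain ⟨β, hβ⟩ := hY x
  rw [form_apply_congr α hβ.symm, P.skew, hα, map_zero, neg_zero]

/-- On a regular Poisson manifold the vector fields tangent to the symplectic leaves are locally in
the image of `#`. -/
lemma IsRegular.exists_local_sharp {P : PoissonStructure E M} (hP : P.IsRegular) (x₀ : M) :
    ∃ G : SmoothFunctions E M, G x₀ ≠ 0 ∧
      ∀ Y ∈ P.tangentFields, ∃ α : OneForms E M, P.sharp α = G • Y := by
  obtain ⟨r, hr⟩ := hP
  have hfin : ∀ x : M, FiniteDimensional ℝ (TangentSpace 𝓘(ℝ, E) x) := fun _ =>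
    inferInstanceAs (FiniteDimensional ℝ E)
  let v := Module.finBasisOfFinrankEq ℝ (P.leafTangent x₀) (hr x₀)
  have hγ : ∀ j, ∃ γ : OneForms E M, P.sharp γ x₀ = v j := fun j => (v j).2
  choose γ hγ using hγ
  -- Functions whose differentials at x₀ restrict to the basis dual to the γ_j^#(x₀) on the leaf
  -- tangent space.
  have hg : ∀ i, ∃ g : SmoothFunctions E M, ∀ j, lieDeriv (P.sharp (γ j)) g x₀ =
      if i = j then 1 else 0 := fun i => by
    obtain ⟨c, hc⟩ := (v.coord i).exists_extend
    obtain ⟨g, hg⟩ := exists_lieDeriv_eq x₀ (LinearMap.toContinuousLinearMap (show E →ₗ[ℝ] ℝ from c))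
    refine ⟨g, fun j => (hg _).trans ?_⟩
    have h1 : c (v j) = v.coord i (v j) := LinearMap.congr_fun hc (v j)
    rw [hγ]
    refine h1.trans ?_
    simp [Finsupp.single_apply, eq_comm]
  choose g hg using hg
  let A : Matrix (Fin r) (Fin r) (SmoothFunctions E M) := fun i j => lieDeriv (P.sharp (γ j)) (g i)
  have hdet : A.det x₀ = 1 := by
    have h1 : (evalFun x₀).mapMatrix A = 1 := by
      ext i j
      exact (hg i j).trans (Matrix.one_apply).symm
    have h2 := RingHom.map_det (evalFun x₀) A
    rwa [h1, Matrix.det_one] at h2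
  -- Regularity enters here: where det A ≠ 0 the dg_i map the leaf tangent space onto ℝ^r, and it
  -- has dimension r at every point, so they are also injective on it.
  have hinj : ∀ x, A.det x ≠ 0 → ∀ w ∈ P.leafTangent x,
      (∀ i, mvfderiv 𝓘(ℝ, E) (g i) x w = 0) → w = 0 := by
    intro x hx w hw h0
    let Λ : P.leafTangent x →ₗ[ℝ] Fin r → ℝ :=
      LinearMap.pi fun i => (mvfderiv 𝓘(ℝ, E) (g i) x).toLinearMap ∘ₗ (P.leafTangent x).subtype
    have hsurj : Function.Surjective Λ := by
      intro c
      let B := (evalFun x).mapMatrix A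
      have hB : IsUnit B.det := by
        rw [← RingHom.map_det]
        exact isUnit_iff_ne_zero.2 hx
      refine ⟨∑ j, (B⁻¹.mulVec c) j • ⟨P.sharp (γ j) x, γ j, rfl⟩, ?_⟩
      have hΛ : ∀ j, Λ ⟨P.sharp (γ j) x, γ j, rfl⟩ = fun i => B i j := fun j => rfl
      have h3 : B.mulVec (B⁻¹.mulVec c) = c := by
        rw [Matrix.mulVec_mulVec, Matrix.mul_nonsing_inv _ hB, Matrix.one_mulVec]
      rw [map_sum]
      conv_rhs => rw [← h3]
      ext i
      simp only [map_smul, hΛ, Finset.sum_apply, Pi.smul_apply, smul_eq_mul]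
      exact Finset.sum_congr rfl fun j _ => mul_comm _ _
    have hΛ := (LinearMap.injective_iff_surjective_of_finrank_eq_finrank
      (by rw [hr x, Module.finrank_fin_fun])).2 hsurj
    have h1 : Λ ⟨w, hw⟩ = Λ 0 := by
      rw [map_zero]
      ext i
      exact h0 i
    exact congrArg Subtype.val (hΛ h1)
  -- One factor det A is the denominator in Cramer's rule; the other makes the identity trivial at
  -- the points where det A = 0 and the dg_i need not separate tangent vectors.
  refine ⟨A.det * A.det, ?_, fun Y hY => ?_⟩
  · change A.det x₀ * A.det x₀ ≠ 0
    rw [hdet]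
    norm_num
  · let δ : Fin r → SmoothFunctions E M := fun i => lieDeriv Y (g i)
    let h := A.adjugate.mulVec δ
    let β : OneForms E M := ∑ j, h j • γ j
    refine ⟨A.det • β, ?_⟩
    rw [map_smul, mul_smul, ← sub_eq_zero, ← smul_sub]
    -- Cramer's rule: the adjugate chooses the coefficients of β so that β^# and det A · Y have the
    -- same derivatives of all g_i.
    have hZ : ∀ i, differential (g i) (P.sharp β - A.det • Y) = 0 := fun i => by
      have h1 : A.mulVec h = A.det • δ := by
        rw [Matrix.mulVec_mulVec, Matrix.mul_adjugate, Matrix.smul_mulVec, Matrix.one_mulVec]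
      have h2 : differential (g i) (P.sharp β) = A.mulVec h i := by
        rw [map_sum, map_sum]
        simp only [map_smul, smul_eq_mul]
        exact Finset.sum_congr rfl fun j _ => mul_comm _ _
      rw [map_sub, map_smul, h2, h1]
      exact sub_self _
    have hmem : P.sharp β - A.det • Y ∈ P.tangentFields :=
      sub_mem (P.sharp_mem_tangentFields β) (P.tangentFields.smul_mem _ hY)
    ext x
    rw [smul_vectorField_apply]
    by_cases hx : A.det x = 0
    · rw [hx, zero_smul]; rfl
    · rw [hinj x hx _ (hmem x) fun i => congrArg (fun f : SmoothFunctions E M => f x) (hZ i),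
        smul_zero]
      rfl

variable {P} (ν : P.TransversalDistribution)

lemma eq_zero_of_mem_tangentForms_of_sharp_eq_zero {α : OneForms E M} (hα : α ∈ ν.tangentForms)
    (h : P.sharp α = 0) : α = 0 :=
  Submodule.disjoint_def.1 ν.isCompl_forms.disjoint α hα (P.form_eq_zero_on_tangentFields h)

/-- On a regular Poisson manifold, `#` maps the `1`-forms vanishing on the transversal distribution
onto the vector fields tangent to the symplectic leaves. -/
lemma IsRegular.exists_sharp_eq (hP : P.IsRegular) {X : VectorFields E M}
    (hX : X ∈ P.tangentFields) : ∃ α ∈ ν.tangentForms, P.sharp α = X := by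
  have hloc : ∀ x : M, ∃ (G : SmoothFunctions E M) (α : OneForms E M), G x ≠ 0 ∧
      α ∈ ν.tangentForms ∧ P.sharp α = G • X := fun x => by
    obtain ⟨G, hG, h⟩ := hP.exists_local_sharp x
    obtain ⟨α, hα⟩ := h X hX
    obtain ⟨t, n, ht, hn, rfl⟩ := Submodule.codisjoint_iff_exists_add_eq.1
      ν.isCompl_forms.codisjoint α
    -- Dropping the normal part does not change the image under # and makes the local solutions
    -- unique, # being injective on T^*F. Uniqueness is what lets them glue.
    rw [map_add, P.form_sharp_eq_zero hn, add_zero] at hα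
    exact ⟨G, t, hG, ht, hα⟩
  choose G α hG hαT hα using hloc
  have hG : Separates G := hG
  obtain ⟨a, ha⟩ := hG.exists_dual (α := α) fun x y => by
    rw [← sub_eq_zero]
    refine eq_zero_of_mem_tangentForms_of_sharp_eq_zero ν
      (sub_mem (Submodule.smul_mem _ _ (hαT x)) (Submodule.smul_mem _ _ (hαT y))) ?_
    rw [map_sub, map_smul, map_smul, hα, hα, smul_smul, smul_smul, mul_comm, sub_self]
  refine ⟨a, (Submodule.mem_dualAnnihilator a).2 fun Z hZ => hG.eq fun x => ?_,
    hG.field_eq fun x => ?_⟩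
  · have h1 := LinearMap.congr_fun (ha x) Z
    rw [(Submodule.mem_dualAnnihilator _).1 (hαT x) Z hZ] at h1
    rw [mul_zero]
    exact h1
  · rw [← map_smul, ha, hα]

/-- Tangent fields are of the form α^#, and [α^#, β^#] = {α, β}^# is again in the image of #. -/
lemma IsRegular.bracket_mem_tangentFields (hP : P.IsRegular) (ν : P.TransversalDistribution)
    {X Y : VectorFields E M} (hX : X ∈ P.tangentFields) (hY : Y ∈ P.tangentFields) :
    (tangentBracket E M).bracket X Y ∈ P.tangentFields := by
  obtain ⟨α, -, rfl⟩ := hP.exists_sharp_eq ν hX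
  obtain ⟨β, -, rfl⟩ := hP.exists_sharp_eq ν hY
  have h := P.sharp_mem_tangentFields (P.formBracket α β)
  rwa [sharp_formBracket] at h

end PoissonStructure
end Poisson
namespace AnchoredBracket

variable {A L : Type*} [CommRing A] [Algebra ℝ A] [AddCommGroup L] [Module A L]
  {K : AnchoredBracket A L} {T N : Submodule A L}

/-! ### Cochains of type `(1, 0)` -/

/-- The cochains of type `(1, 0)` are the linear functions vanishing on `T`. -/
noncomputable def ofTypeOneEquiv (T N : Submodule A L) :
    ofType T N 1 (1 + 0) ≃ₗ[A] T.dualAnnihilator where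
  toFun η := ⟨(AlternatingMap.ofSubsingleton A L A (0 : Fin 1)).symm η.1, by
    refine (Submodule.mem_dualAnnihilator _).2 fun x hx => ?_
    exact η.2 ∅ (by simp) (fun _ => x) (by simp) (fun _ _ => hx)⟩
  invFun l := ⟨AlternatingMap.ofSubsingleton A L A (0 : Fin 1) l.1, by
    intro S hS x hN hT
    have h0 : (0 : Fin 1) ∉ S := fun h => hS (by
      have hS' : S = (Finset.univ : Finset (Fin 1)) :=
        Finset.eq_univ_iff_forall.2 fun i => (Subsingleton.elim (0 : Fin 1) i) ▸ h
      rw [hS']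
      rfl)
    exact (Submodule.mem_dualAnnihilator _).1 l.2 _ (hT _ h0)⟩
  map_add' _ _ := rfl
  map_smul' _ _ := rfl
  left_inv η := Subtype.ext (Equiv.apply_symm_apply _ _)
  right_inv l := Subtype.ext (Equiv.symm_apply_apply _ _)

/-- With D the Koszul differential, Dη(x, y) = x(η(y)) − y(η(x)) − η([x, y]), and η(x) = 0 since η
kills T. For x tangent and y normal this value is also that of the leafwise component. -/
lemma anchor_eq_of_leafDifferential_eq_zero (h : IsCompl T N) (I : Subalgebra ℝ A)
    (hI : ∀ f ∈ I, ∀ x ∈ T, K.anchor x f = 0) {η : ofType T N 1 (1 + 0)}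
    (hη : K.leafDifferential h I hI 1 (1 + 0) η = 0) {x y : L} (hx : x ∈ T) (hy : y ∈ N) :
    (ofTypeOneEquiv T N η : Module.Dual A L) (K.bracket x y) =
      K.anchor x ((ofTypeOneEquiv T N η : Module.Dual A L) y) := by
  set η' : L [⋀^Fin 1]→ₗ[A] A := η.1 with hη'
  have hval : ∀ v : Fin 1 → L, η' v = (ofTypeOneEquiv T N η : Module.Dual A L) (v 0) := fun v =>
    congrArg η' (funext fun i => congrArg v (Subsingleton.elim i 0))
  have h1 : component h 1 (K.koszul η') = 0 := congrArg Subtype.val hη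
  have hl : HasLabels T N (Fin.cons false fun _ => true : Fin 2 → Bool)
      (Fin.cons x fun _ => y : Fin 2 → L) := fun i => Fin.cases hx (fun _ => hy) i
  have h2 := component_apply_of_hasLabels (p := 1) h (K.koszul η') hl
    (by rw [labelCount_cons]; simp [labelCount])
  rw [h1, koszul_cons_succ] at h2
  have h3 : K.koszul (η'.curryLeft x) (fun _ => y) = 0 := by
    have e : (fun _ : Fin 1 => y) = Fin.cons y (fun i : Fin 0 => i.elim0) :=
      funext fun i => by rw [Subsingleton.elim i 0]; rfl
    rw [e, koszul_apply_zero, AlternatingMap.curryLeft_apply_apply, hval]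
    have h4 := (Submodule.mem_dualAnnihilator _).1 (ofTypeOneEquiv T N η).2 x hx
    exact (congrArg (K.anchor y) h4).trans (map_zero _)
  rw [h3] at h2
  simp only [Fin.sum_univ_succ, Finset.univ_eq_empty, Finset.sum_empty, add_zero, hval, Fin.cons_zero,
    Fin.val_zero, pow_zero, one_mul, sub_zero, AlternatingMap.zero_apply] at h2
  exact (sub_eq_zero.1 h2.symm).symm

end AnchoredBracket

/-! ### The isomorphism from 1-forms to vector fields defined by the two frames -/

section Frames

variable {E : Type*} [NormedAddCommGroup E] [NormedSpace ℝ E]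
  {M : Type*} [TopologicalSpace M] [ChartedSpace E M] [IsManifold 𝓘(ℝ, E) ∞ M]
  [FiniteDimensional ℝ E] [T2Space M]

/-- Reflexivity lets a functional on 1-forms be used as a vector field, both for the X_j and in the
construction of `frameMap`. -/
instance : Module.IsReflexive (SmoothFunctions E M) (VectorFields E M) where
  bijective_dual_eval' :=
    ⟨fun _ _ h => field_ext_forms fun α => LinearMap.congr_fun h α, fun ξ => by
      obtain ⟨X, hX⟩ := exists_field_of_bidual ξ
      exact ⟨X, LinearMap.ext fun α => (hX α).symm⟩⟩

namespace PoissonStructure.TransversalDistribution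

variable {P : PoissonStructure E M} (ν : P.TransversalDistribution)

lemma mem_normalFields_of_forms {Z : VectorFields E M} (h : ∀ γ ∈ ν.tangentForms, γ Z = 0) :
    Z ∈ ν.normalFields := by
  obtain ⟨t, n, ht, hn, rfl⟩ := Submodule.codisjoint_iff_exists_add_eq.1
    ν.isCompl_fields.codisjoint Z
  have h0 : t = 0 := field_ext_forms fun γ => by
    obtain ⟨γt, γn, hγt, hγn, rfl⟩ := Submodule.codisjoint_iff_exists_add_eq.1
      ν.isCompl_forms.codisjoint γ
    have h1 := h γt hγt
    rw [map_add, (Submodule.mem_dualAnnihilator γt).1 hγt n hn, add_zero] at h1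
    rw [LinearMap.add_apply, h1, (Submodule.mem_dualAnnihilator γn).1 hγn t ht, map_zero, add_zero]
  rw [h0, zero_add]
  exact hn

lemma mem_tangentFields_of_forms {Z : VectorFields E M} (h : ∀ γ ∈ ν.normalForms, γ Z = 0) :
    Z ∈ P.tangentFields := by
  obtain ⟨t, n, ht, hn, rfl⟩ := Submodule.codisjoint_iff_exists_add_eq.1
    ν.isCompl_fields.codisjoint Z
  have h0 : n = 0 := field_ext_forms fun γ => by
    obtain ⟨γt, γn, hγt, hγn, rfl⟩ := Submodule.codisjoint_iff_exists_add_eq.1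
      ν.isCompl_forms.codisjoint γ
    have h1 := h γn hγn
    rw [map_add, (Submodule.mem_dualAnnihilator γn).1 hγn t ht, zero_add] at h1
    rw [LinearMap.add_apply, h1, (Submodule.mem_dualAnnihilator γt).1 hγt n hn, map_zero, add_zero]
  rw [h0, add_zero]
  exact ht

variable {ι : Type*} (β : Module.Basis ι (SmoothFunctions E M) ν.normalForms)
  (X : Module.Basis ι (SmoothFunctions E M) ν.tangentForms.dualAnnihilator)

lemma mem_tangentFields_of_basis {Z : VectorFields E M}
    (h : ∀ j, (β j : OneForms E M) Z = 0) : Z ∈ P.tangentFields := by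
  refine ν.mem_tangentFields_of_forms fun γ hγ => ?_
  have h1 : Module.Dual.eval (SmoothFunctions E M) (VectorFields E M) Z ∘ₗ
      ν.normalForms.subtype = 0 := β.ext h
  exact LinearMap.congr_fun h1 ⟨γ, hγ⟩

/-- The map from `1`-forms to normal vector fields which is characterized by
`β_j(frameMap α) = X_j(α)`. -/
noncomputable def frameMap : OneForms E M →ₗ[SmoothFunctions E M] VectorFields E M :=
  -- From the last factor to the first: α gives the family (X_j(α))_j, this gives the functional on
  -- ν^*F with β_j ↦ X_j(α), which is extended by 0 on T^*F and read as a vector field.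
  (Module.evalEquiv (SmoothFunctions E M) (VectorFields E M)).symm.toLinearMap ∘ₗ
    LinearMap.lcomp (SmoothFunctions E M) (SmoothFunctions E M)
      (ν.normalForms.projectionOnto ν.tangentForms ν.isCompl_forms.symm) ∘ₗ
    (β.constr (SmoothFunctions E M)).toLinearMap ∘ₗ
    LinearMap.pi fun j => (X j : Module.Dual (SmoothFunctions E M) (OneForms E M))

lemma apply_frameMap (α γ : OneForms E M) :
    γ (ν.frameMap β X α) = β.constr (SmoothFunctions E M)
      (fun j => (X j : Module.Dual (SmoothFunctions E M) (OneForms E M)) α)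
      (ν.normalForms.projectionOnto ν.tangentForms ν.isCompl_forms.symm γ) :=
  Module.apply_evalEquiv_symm_apply _ _ _ _

lemma basis_apply_frameMap (α : OneForms E M) (j : ι) :
    (β j : OneForms E M) (ν.frameMap β X α) =
      (X j : Module.Dual (SmoothFunctions E M) (OneForms E M)) α := by
  rw [apply_frameMap, Submodule.projectionOnto_apply_left, Module.Basis.constr_basis]

lemma frameMap_mem (α : OneForms E M) : ν.frameMap β X α ∈ ν.normalFields :=
  ν.mem_normalFields_of_forms fun γ hγ => by
    rw [apply_frameMap, Submodule.projectionOnto_apply_of_mem_right _ hγ, map_zero]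

lemma frameMap_eq_zero {α : OneForms E M} (hα : α ∈ ν.tangentForms) : ν.frameMap β X α = 0 := by
  refine Submodule.disjoint_def.1 ν.isCompl_fields.disjoint _
    (ν.mem_tangentFields_of_basis β fun j => ?_) (ν.frameMap_mem β X α)
  rw [basis_apply_frameMap]
  exact (Submodule.mem_dualAnnihilator _).1 (X j).2 α hα

lemma eval_mem_dualAnnihilator {Z : VectorFields E M} (hZ : Z ∈ ν.normalFields) :
    Module.Dual.eval (SmoothFunctions E M) (VectorFields E M) Z ∈
      ν.tangentForms.dualAnnihilator :=
  (Submodule.mem_dualAnnihilator _).2 fun γ hγ => (Submodule.mem_dualAnnihilator γ).1 hγ Z hZ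

/-- All X_j(α) vanish, and the X_j span the functionals coming from normal fields, so α vanishes on
νF as well as on TF. -/
lemma eq_zero_of_frameMap_eq_zero {α : OneForms E M} (hα : α ∈ ν.normalForms)
    (h : ν.frameMap β X α = 0) : α = 0 := by
  have h1 : Module.Dual.eval (SmoothFunctions E M) (OneForms E M) α ∘ₗ
      ν.tangentForms.dualAnnihilator.subtype = 0 := X.ext fun j => by
    have h2 := ν.basis_apply_frameMap β X α j
    rw [h, map_zero] at h2
    exact h2.symm
  refine LinearMap.ext fun Z => ?_
  obtain ⟨t, n, ht, hn, rfl⟩ := Submodule.codisjoint_iff_exists_add_eq.1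
    ν.isCompl_fields.codisjoint Z
  rw [map_add, (Submodule.mem_dualAnnihilator α).1 hα t ht, zero_add]
  exact LinearMap.congr_fun h1 ⟨_, ν.eval_mem_dualAnnihilator hn⟩

lemma exists_frameMap_eq {Y : VectorFields E M} (hY : Y ∈ ν.normalFields) :
    ∃ α ∈ ν.normalForms, ν.frameMap β X α = Y := by
  let u : ν.normalFields →ₗ[SmoothFunctions E M] ν.tangentForms.dualAnnihilator :=
    (Module.Dual.eval (SmoothFunctions E M) (VectorFields E M)).restrict
      fun _ hZ => ν.eval_mem_dualAnnihilator hZ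
  -- The preimage is prescribed on the dual side: α takes the value β_j(Y) on the normal field
  -- corresponding to X_j. Then `frameMap` of α and Y agree under all β_j, and a normal field is
  -- determined by these values.
  let c := X.constr (SmoothFunctions E M) fun j => (β j : OneForms E M) Y
  let α : OneForms E M := c ∘ₗ u ∘ₗ
    ν.normalFields.projectionOnto P.tangentFields ν.isCompl_fields.symm
  have hα : α ∈ ν.normalForms := (Submodule.mem_dualAnnihilator α).2 fun Z hZ => by
    change c (u (ν.normalFields.projectionOnto P.tangentFields ν.isCompl_fields.symm Z)) = 0
    rw [Submodule.projectionOnto_apply_of_mem_right _ hZ, map_zero, map_zero]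
  have hX : ∀ j, (X j : Module.Dual (SmoothFunctions E M) (OneForms E M)) α =
      (β j : OneForms E M) Y := fun j => by
    obtain ⟨W, hW⟩ := exists_field_of_bidual
      (X j : Module.Dual (SmoothFunctions E M) (OneForms E M))
    have hWN : W ∈ ν.normalFields := ν.mem_normalFields_of_forms fun γ hγ => by
      rw [← hW]
      exact (Submodule.mem_dualAnnihilator _).1 (X j).2 γ hγ
    have hu : u ⟨W, hWN⟩ = X j := Subtype.ext (LinearMap.ext fun γ => (hW γ).symm)
    rw [hW]
    change c (u (ν.normalFields.projectionOnto P.tangentFields ν.isCompl_fields.symm W)) = _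
    rw [Submodule.projectionOnto_apply_of_mem_left _ hWN, hu, Module.Basis.constr_basis]
  refine ⟨α, hα, sub_eq_zero.1 (Submodule.disjoint_def.1 ν.isCompl_fields.disjoint _
    (ν.mem_tangentFields_of_basis β fun j => ?_) (sub_mem (ν.frameMap_mem β X α) hY))⟩
  rw [map_sub, basis_apply_frameMap, hX, sub_self]

/-- The map from `1`-forms to vector fields which is `#` on the tangent forms and `frameMap` on the
normal ones. -/
noncomputable def formsToFields : OneForms E M →ₗ[SmoothFunctions E M] VectorFields E M :=
  P.sharp + ν.frameMap β X

lemma formsToFields_of_tangent {α : OneForms E M} (hα : α ∈ ν.tangentForms) :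
    ν.formsToFields β X α = P.sharp α := by
  rw [formsToFields, LinearMap.add_apply, frameMap_eq_zero ν β X hα, add_zero]

lemma formsToFields_of_normal {α : OneForms E M} (hα : α ∈ ν.normalForms) :
    ν.formsToFields β X α = ν.frameMap β X α := by
  rw [formsToFields, LinearMap.add_apply, P.form_sharp_eq_zero hα, zero_add]

lemma formsToFields_mem_tangent_iff (α : OneForms E M) :
    α ∈ ν.tangentForms ↔ ν.formsToFields β X α ∈ P.tangentFields := by
  constructor
  · intro hα
    rw [ν.formsToFields_of_tangent β X hα]
    exact P.sharp_mem_tangentFields α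
  · intro h
    obtain ⟨t, n, ht, hn, rfl⟩ := Submodule.codisjoint_iff_exists_add_eq.1
      ν.isCompl_forms.codisjoint α
    rw [map_add, ν.formsToFields_of_tangent β X ht, ν.formsToFields_of_normal β X hn,
      Submodule.add_mem_iff_right _ (P.sharp_mem_tangentFields t)] at h
    have h0 := Submodule.disjoint_def.1 ν.isCompl_fields.disjoint _ h (ν.frameMap_mem β X n)
    rw [ν.eq_zero_of_frameMap_eq_zero β X hn h0, add_zero]
    exact ht

lemma formsToFields_mem_normal_iff (α : OneForms E M) :
    α ∈ ν.normalForms ↔ ν.formsToFields β X α ∈ ν.normalFields := by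
  constructor
  · intro hα
    rw [ν.formsToFields_of_normal β X hα]
    exact ν.frameMap_mem β X α
  · intro h
    obtain ⟨t, n, ht, hn, rfl⟩ := Submodule.codisjoint_iff_exists_add_eq.1
      ν.isCompl_forms.codisjoint α
    rw [map_add, ν.formsToFields_of_tangent β X ht, ν.formsToFields_of_normal β X hn,
      Submodule.add_mem_iff_left _ (ν.frameMap_mem β X n)] at h
    have h0 := Submodule.disjoint_def.1 ν.isCompl_fields.disjoint _
      (P.sharp_mem_tangentFields t) h
    rw [eq_zero_of_mem_tangentForms_of_sharp_eq_zero ν ht h0, zero_add]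
    exact hn

lemma formsToFields_bijective (hP : P.IsRegular) :
    Function.Bijective (ν.formsToFields β X) := by
  constructor
  · rw [injective_iff_map_eq_zero]
    intro α hα
    refine Submodule.disjoint_def.1 ν.isCompl_forms.disjoint α
      ((ν.formsToFields_mem_tangent_iff β X α).2 ?_) ((ν.formsToFields_mem_normal_iff β X α).2 ?_)
    · rw [hα]; exact zero_mem _
    · rw [hα]; exact zero_mem _
  · intro Z
    obtain ⟨t, n, ht, hn, rfl⟩ := Submodule.codisjoint_iff_exists_add_eq.1
      ν.isCompl_fields.codisjoint Z
    obtain ⟨α, hα, rfl⟩ := hP.exists_sharp_eq ν ht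
    obtain ⟨γ, hγ, rfl⟩ := ν.exists_frameMap_eq β X hn
    exact ⟨α + γ, by
      rw [map_add, ν.formsToFields_of_tangent β X hα, ν.formsToFields_of_normal β X hγ]⟩

/-- The # parts cancel because # is a morphism of brackets, which leaves the `frameMap` of {α, γ}, a
normal field. -/
lemma formsToFields_bracket_tangent {α γ : OneForms E M} (hα : α ∈ ν.tangentForms)
    (hγ : γ ∈ ν.tangentForms) :
    ν.formsToFields β X (P.cotangentBracket.bracket α γ) -
      (tangentBracket E M).bracket (ν.formsToFields β X α) (ν.formsToFields β X γ) ∈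
      ν.normalFields := by
  have h : P.sharp (P.cotangentBracket.bracket α γ) =
      (tangentBracket E M).bracket (P.sharp α) (P.sharp γ) := P.sharp_formBracket α γ
  rw [ν.formsToFields_of_tangent β X hα, ν.formsToFields_of_tangent β X hγ, formsToFields,
    LinearMap.add_apply, h, add_sub_cancel_left]
  exact ν.frameMap_mem β X _

/-- β_j of the first term is X_j({α, γ}) = α^#(X_j(γ)), while β_j of the second is α^#(β_j(Φγ)), and
β_j(Φγ) = X_j(γ). A field killed by all β_j is tangent. -/
lemma formsToFields_bracket_normal
    (hβ : ∀ j, ∀ Y ∈ P.tangentFields, ∀ Z ∈ ν.normalFields,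
      (β j : OneForms E M) ((tangentBracket E M).bracket Y Z) =
        (tangentBracket E M).anchor Y ((β j : OneForms E M) Z))
    (hX : ∀ j, ∀ α ∈ ν.tangentForms, ∀ γ ∈ ν.normalForms,
      (X j : Module.Dual (SmoothFunctions E M) (OneForms E M)) (P.cotangentBracket.bracket α γ) =
        P.cotangentBracket.anchor α
          ((X j : Module.Dual (SmoothFunctions E M) (OneForms E M)) γ))
    {α γ : OneForms E M} (hα : α ∈ ν.tangentForms) (hγ : γ ∈ ν.normalForms) :
    ν.formsToFields β X (P.cotangentBracket.bracket α γ) -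
      (tangentBracket E M).bracket (ν.formsToFields β X α) (ν.formsToFields β X γ) ∈
      P.tangentFields := by
  refine ν.mem_tangentFields_of_basis β fun j => ?_
  have h1 : (β j : OneForms E M) (P.sharp (P.cotangentBracket.bracket α γ)) = 0 :=
    (Submodule.mem_dualAnnihilator _).1 (β j).2 _ (P.sharp_mem_tangentFields _)
  rw [ν.formsToFields_of_tangent β X hα, ν.formsToFields_of_normal β X hγ, map_sub,
    hβ j _ (P.sharp_mem_tangentFields α) _ (ν.frameMap_mem β X γ), basis_apply_frameMap,
    formsToFields, LinearMap.add_apply, map_add, h1, zero_add, basis_apply_frameMap,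
    hX j α hα γ hγ]
  exact sub_self _

/-- A linear isomorphism from `1`-forms to vector fields which respects the decompositions, extends
`#` on the tangent forms, and is compatible with the components of the brackets which matter for the
leafwise operators. -/
lemma exists_formsEquiv (hP : P.IsRegular)
    (hβ : ∀ j, ∀ Y ∈ P.tangentFields, ∀ Z ∈ ν.normalFields,
      (β j : OneForms E M) ((tangentBracket E M).bracket Y Z) =
        (tangentBracket E M).anchor Y ((β j : OneForms E M) Z))
    (hX : ∀ j, ∀ α ∈ ν.tangentForms, ∀ γ ∈ ν.normalForms,
      (X j : Module.Dual (SmoothFunctions E M) (OneForms E M)) (P.cotangentBracket.bracket α γ) =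
        P.cotangentBracket.anchor α
          ((X j : Module.Dual (SmoothFunctions E M) (OneForms E M)) γ)) :
    ∃ Φ : OneForms E M ≃ₗ[SmoothFunctions E M] VectorFields E M,
      (∀ α, α ∈ ν.tangentForms ↔ Φ α ∈ P.tangentFields) ∧
      (∀ α, α ∈ ν.normalForms ↔ Φ α ∈ ν.normalFields) ∧
      (∀ α ∈ ν.tangentForms, P.cotangentBracket.anchor α = (tangentBracket E M).anchor (Φ α)) ∧
      (∀ α ∈ ν.tangentForms, ∀ γ ∈ ν.tangentForms, Φ (P.cotangentBracket.bracket α γ) -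
        (tangentBracket E M).bracket (Φ α) (Φ γ) ∈ ν.normalFields) ∧
      ∀ α ∈ ν.tangentForms, ∀ γ ∈ ν.normalForms, Φ (P.cotangentBracket.bracket α γ) -
        (tangentBracket E M).bracket (Φ α) (Φ γ) ∈ P.tangentFields :=
  ⟨LinearEquiv.ofBijective (ν.formsToFields β X) (ν.formsToFields_bijective β X hP),
    ν.formsToFields_mem_tangent_iff β X, ν.formsToFields_mem_normal_iff β X,
    fun _ hα => congrArg (tangentBracket E M).anchor (ν.formsToFields_of_tangent β X hα).symm,
    fun _ hα _ hγ => ν.formsToFields_bracket_tangent β X hα hγ,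
    fun _ hα _ hγ => ν.formsToFields_bracket_normal β X hβ hX hα hγ⟩

lemma nonempty_leafCohomology_equiv {p : ℕ}
    (e : ∀ q : ℕ, ν.FormsOfType p q ≃ₗ[P.casimirs] ν.MultivectorsOfType p q)
    (he : ∀ (q : ℕ) (η : ν.FormsOfType p q),
      e (q + 1) (ν.dLeaf p q η) = ν.sigmaLeaf p q (e q η)) (q : ℕ) :
    Nonempty (ν.LeafCohomology p q ≃ₗ[P.casimirs] ν.SigmaCohomology p q) := by
  have h₁ := nonempty_cohomology_equiv (R := P.casimirs) (C := fun k => ν.FormsOfType p k)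
    (D := fun k => ν.MultivectorsOfType p k)
  have h₂ := h₁ fun k => ν.dLeaf p k
  have h₃ := h₂ fun k => ν.sigmaLeaf p k
  have h₄ := h₃ e
  have h₅ := h₄ he q
  exact h₅

end PoissonStructure.TransversalDistribution
end Frames
end TangentialPoisson

/-! ### The isomorphism of complexes -/

theorem proposition5 {E : Type*} [NormedAddCommGroup E] [NormedSpace ℝ E] [FiniteDimensional ℝ E]
    {M : Type*} [TopologicalSpace M] [ChartedSpace E M] [IsManifold 𝓘(ℝ, E) ∞ M]
    [T2Space M] [ParacompactSpace M]
    (P : PoissonStructure E M) (hP : P.IsRegular) (ν : P.TransversalDistribution)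
    {ι : Type*}
    (β : Module.Basis ι (SmoothFunctions E M) (ν.FormsOfType 1 0))
    (X : Module.Basis ι (SmoothFunctions E M) (ν.MultivectorsOfType 1 0))
    (hβ : ∀ i, ν.dLeaf 1 0 (β i) = 0) (hX : ∀ i, ν.sigmaLeaf 1 0 (X i) = 0) (p : ℕ) :
    (∀ (q : ℕ) (η : ν.FormsOfType p q), ν.dLeaf p (q + 1) (ν.dLeaf p q η) = 0) ∧
    (∀ (q : ℕ) (Q : ν.MultivectorsOfType p q), ν.sigmaLeaf p (q + 1) (ν.sigmaLeaf p q Q) = 0) ∧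
    (∃ e : ∀ q : ℕ, ν.FormsOfType p q ≃ₗ[P.casimirs] ν.MultivectorsOfType p q,
      ∀ (q : ℕ) (η : ν.FormsOfType p q), e (q + 1) (ν.dLeaf p q η) = ν.sigmaLeaf p q (e q η)) ∧
    (∀ q : ℕ, Nonempty (ν.LeafCohomology p q ≃ₗ[P.casimirs] ν.SigmaCohomology p q)) := by
  have hd : ∀ (q : ℕ) (η : ν.FormsOfType p q), ν.dLeaf p (q + 1) (ν.dLeaf p q η) = 0 :=
    fun q η => AnchoredBracket.leafDifferential_leafDifferential tangentBracket_isLie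
      ν.isCompl_fields (fun _ hY _ hZ => hP.bracket_mem_tangentFields ν hY hZ) P.casimirs _ p
      (p + q) η
  obtain ⟨β', hβ'⟩ : ∃ β' : Module.Basis ι (SmoothFunctions E M) ν.normalForms,
      ∀ j, β' j = AnchoredBracket.ofTypeOneEquiv P.tangentFields ν.normalFields (β j) :=
    ⟨β.map (AnchoredBracket.ofTypeOneEquiv P.tangentFields ν.normalFields), fun _ => rfl⟩
  obtain ⟨X', hX'⟩ : ∃ X' : Module.Basis ι (SmoothFunctions E M) ν.tangentForms.dualAnnihilator,
      ∀ j, X' j = AnchoredBracket.ofTypeOneEquiv ν.tangentForms ν.normalForms (X j) :=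
    ⟨X.map (AnchoredBracket.ofTypeOneEquiv ν.tangentForms ν.normalForms), fun _ => rfl⟩
  obtain ⟨Φ, hΦT, hΦN, hanchor, hTT, hTN⟩ := ν.exists_formsEquiv β' X' hP
    (fun j Y hY Z hZ => by
      rw [hβ']
      exact AnchoredBracket.anchor_eq_of_leafDifferential_eq_zero ν.isCompl_fields P.casimirs _
        (hβ j) hY hZ)
    (fun j α hα γ hγ => by
      rw [hX']
      exact AnchoredBracket.anchor_eq_of_leafDifferential_eq_zero ν.isCompl_forms P.casimirs _
        (hX j) hα hγ)
  obtain ⟨e, he⟩ : ∃ e : ∀ q : ℕ, ν.FormsOfType p q ≃ₗ[P.casimirs] ν.MultivectorsOfType p q,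
      ∀ (q : ℕ) (η : ν.FormsOfType p q), e (q + 1) (ν.dLeaf p q η) = ν.sigmaLeaf p q (e q η) :=
    ⟨fun q => AnchoredBracket.ofTypeCongr P.casimirs Φ hΦT hΦN p (p + q), fun q η =>
      AnchoredBracket.ofTypeCongr_leafDifferential _ ν.isCompl_fields ν.isCompl_forms hΦT hΦN
        hanchor hTT hTN P.casimirs _ _ p (p + q) η⟩
  refine ⟨hd, fun q Q => ?_, ⟨e, he⟩, fun q => ?_⟩
  -- σ''² = 0 follows from d''² = 0, since e is onto and intertwines the two operators.
  · obtain ⟨η, rfl⟩ := (e q).surjective Q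
    rw [← he, ← he, hd, map_zero]
  · exact ν.nonempty_leafCohomology_equiv e he q
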